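/- Let $\mathbf{k}$ be a field and $\Omega$ a set. All operads are symmetric, reduced and $\mathbf{k}$-linear; $\mathcal{F}(W)$ is the free operad on an $\mathbb{S}$-module $W$, and $\mathcal{P}(W,R)=\mathcal{F}(W)/(R)$ is its quotient by the operadic ideal generated by $R$. **Pre-induced operad.** Let $\mathcal{Q}=\mathcal{P}(W,S)$ where $W=W_1\oplus W_2$ is generated by unary operations $\omega$ in a basis $\Omega$ of $W_1$ and binary operations $\theta$ in a basis $\Theta$ of $W_2$ that is stable under $\theta\mapsto\theta'=\theta^{(12)}$. Let $V_{\Omega,\Theta}$ be the $S_2$-module with basis $\{\prec_{\omega,\theta},\succ_{\omega,\theta}\mid \omega\in\Omega,\theta\in\Theta\}$ and action $\prec_{\omega,\theta}^{(12)}=\succ_{\omega,\theta'}$, $\succ_{\omega,\theta}^{(12)}=\prec_{\omega,\theta'}$, and let $\Phi_{\mathcal{Q}}:\mathcal{F}(V_{\Omega,\Theta})\to\mathcal{Q}$ be the operad morphism with $\prec_{\omega,\theta}\mapsto\theta(\mathrm{id}\otimes\omega)$ and $\succ_{\omega,\theta}\mapsto\theta(\omega\otimes\mathrm{id})$. The pre-induced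 operad of $\mathcal{Q}$ is $\mathcal{F}(V_{\Omega,\Theta})/\big(\ker\Phi_{\mathcal{Q}}\cap\mathcal{F}(V_{\Omega,\Theta})(3)\big)$. **The two operads.** Let $\mathrm{NCDA}_\Omega$ be the operad of commutative associative algebras with derivations $\partial_\omega$ $(\omega\in\Omega)$ that need not commute: it is generated by unary operations $\partial_\omega$ and one binary operation $\mu$ with $\mu'=\mu^{(12)}=\mu$ (so $\Theta=\{\mu\}$), with relators $$\mu(\mu\otimes\mathrm{id})-\mu(\mathrm{id}\otimes\mu),\qquad \mu-\mu^{(12)},\qquad \partial_\omega\mu-\mu(\mathrm{id}\otimes\partial_\omega)-\mu(\partial_\omega\otimes\mathrm{id})\quad(\omega\in\Omega).$$ Let $V$ be the $S_2$-module with basis $\{\rhd_\omega,\rhd'_\omega\mid\omega\in\Omega\}$ and $\rhd_\omega^{(12)}=\rhd'_\omega$, concentrated in arity $2$. Let $R\subseteq\mathcal{F}(V)(3)$ be the $\mathbf{k}[S_3]$-submodule generated by $$(x\rhd_\omega y)\rhd_\tau z-x\rhd_\omega(y\rhd_\tau z)-(y\rhd_\omega x)\rhd_\tau z+y\rhd_\omega(x\rhd_\tau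 z),\qquad (x\rhd_\omega y)\rhd_\tau z-(x\rhd_\tau z)\rhd_\omega y,\qquad \omega,\tau\in\Omega.$$ The operad of noncommuting multi-Novikov algebras is $\mathcal{P}(V,R)$. **Theorem.** The operad of noncommuting multi-Novikov algebras is the pre-induced operad of $\mathrm{NCDA}_\Omega$: there is an isomorphism of operads from the former to the latter that sends $\rhd_\omega$ to $\prec_{\omega,\mu}$ and $\rhd'_\omega$ to $\succ_{\omega,\mu}$ for all $\omega\in\Omega$. More precisely, for the operad morphism $\Phi:\mathcal{F}(V)\to\mathrm{NCDA}_\Omega$ with $\rhd_\omega\mapsto\mu(\mathrm{id}\otimes\partial_\omega)$ and $\rhd'_\omega\mapsto\mu'(\partial_\omega\otimes\mathrm{id})$, one has $$\ker\Phi\cap\mathcal{F}(V)(3)=R.$$ -/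

import Mathlib

namespace InducedStructure

universe u v w w'

/-! ## Symmetric operads through partial compositions

Arities are natural numbers and inputs are numbered from `0`.  The arity `r = m + n - 1` of a
partial composition is recorded by an equation `r + 1 = m + n`. -/

/-- Position, among the inputs of `f ∘ᵢ g`, of the `y`-th input of `g`. -/
def inPos {m n r : ℕ} (h : r + 1 = m + n) (i : Fin m) (y : Fin n) : Fin r :=
  ⟨i.1 + y.1, by omega⟩

/-- Position, among the inputs of `f ∘ᵢ g`, of the `x`-th input of `f`, where `x ≠ i`. -/
def outPos {m n r : ℕ} (h : r + 1 = m + n) (i x : Fin m) (hx : x ≠ i) : Fin r :=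
  ⟨if x.1 < i.1 then x.1 else x.1 + n - 1, by
    have : x.1 ≠ i.1 := fun e => hx (Fin.ext e)
    split <;> omega⟩

/-- A reduced symmetric `k`-linear operad: right `k[Sₙ]`-modules `P(n)` with partial compositions
`∘ᵢ : P(m) ⊗ P(n) → P(m + n - 1)`. -/
structure SymmOperad (k : Type u) [Field k] where
  /-- the space of operations of arity `n` -/
  carrier : ℕ → Type w
  [addCommGroup : ∀ n, AddCommGroup (carrier n)]
  [module : ∀ n, Module k (carrier n)]
  /-- the right action of the symmetric group -/
  act : ∀ {n : ℕ}, Equiv.Perm (Fin n) → carrier n →ₗ[k] carrier n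
  /-- the identity operation -/
  one : carrier 1
  /-- `circ h i f g` is the partial composition `f ∘ᵢ g` -/
  circ : ∀ {m n r : ℕ}, r + 1 = m + n → Fin m → carrier m →ₗ[k] carrier n →ₗ[k] carrier r
  reduced : Subsingleton (carrier 0)
  act_one : ∀ {n : ℕ} (x : carrier n), act 1 x = x
  act_mul : ∀ {n : ℕ} (σ τ : Equiv.Perm (Fin n)) (x : carrier n),
    act (σ * τ) x = act τ (act σ x)
  one_circ : ∀ {n : ℕ} (h : n + 1 = 1 + n) (i : Fin 1) (x : carrier n), circ h i one x = x
  circ_one : ∀ {n : ℕ} (h : n + 1 = n + 1) (i : Fin n) (x : carrier n), circ h i x one = x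
  /-- sequential composition: `(η ∘ᵢ μ) ∘ᵢ₊ⱼ ν = η ∘ᵢ (μ ∘ⱼ ν)` -/
  circ_seq : ∀ {l m n r s t : ℕ} (h₁ : r + 1 = l + m) (h₂ : t + 1 = r + n) (h₃ : s + 1 = m + n)
    (h₄ : t + 1 = l + s) (i : Fin l) (j : Fin m)
    (x : carrier l) (y : carrier m) (z : carrier n),
    circ h₂ (inPos h₁ i j) (circ h₁ i x y) z = circ h₄ i x (circ h₃ j y z)
  /-- parallel composition: the inputs `i < j` of `η` can be filled in either order -/
  circ_par : ∀ {l m n r s t : ℕ} (h₁ : r + 1 = l + m) (h₂ : t + 1 = r + n) (h₃ : s + 1 = l + n)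
    (h₄ : t + 1 = s + m) (i j : Fin l) (hij : i < j)
    (x : carrier l) (y : carrier m) (z : carrier n),
    circ h₂ (outPos h₁ i j hij.ne') (circ h₁ i x y) z =
      circ h₄ (outPos h₃ j i hij.ne) (circ h₃ j x z) y
  /-- `μ^σ ∘ᵢ ν = (μ ∘_{σ i} ν)^{σ'}`, where `σ'` is given by `σ` outside the block of `ν` and by
  the order preserving bijection on that block -/
  act_circ : ∀ {m n r : ℕ} (h : r + 1 = m + n) (i : Fin m) (σ : Equiv.Perm (Fin m))
    (σ' : Equiv.Perm (Fin r)) (x : carrier m) (y : carrier n),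
    (∀ b, σ' (inPos h i b) = inPos h (σ i) b) →
    (∀ a (ha : a ≠ i), σ' (outPos h i a ha) = outPos h (σ i) (σ a) (fun e => ha (σ.injective e))) →
    circ h i (act σ x) y = act σ' (circ h (σ i) x y)
  /-- `μ ∘ᵢ ν^τ = (μ ∘ᵢ ν)^{τ'}`, where `τ'` acts by `τ` on the block of `ν` and trivially
  elsewhere -/
  circ_act : ∀ {m n r : ℕ} (h : r + 1 = m + n) (i : Fin m) (τ : Equiv.Perm (Fin n))
    (τ' : Equiv.Perm (Fin r)) (x : carrier m) (y : carrier n),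
    (∀ b, τ' (inPos h i b) = inPos h i (τ b)) →
    (∀ a (ha : a ≠ i), τ' (outPos h i a ha) = outPos h i a ha) →
    circ h i x (act τ y) = act τ' (circ h i x y)

attribute [instance] SymmOperad.addCommGroup SymmOperad.module

namespace SymmOperad

variable {k : Type u} [Field k]

/-- A morphism of operads. -/
structure Hom (P : SymmOperad.{u, w} k) (Q : SymmOperad.{u, w'} k) where
  /-- the component in arity `n` -/
  app : ∀ n, P.carrier n →ₗ[k] Q.carrier n
  app_act : ∀ {n : ℕ} (σ : Equiv.Perm (Fin n)) (x : P.carrier n),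
    app n (P.act σ x) = Q.act σ (app n x)
  app_one : app 1 P.one = Q.one
  app_circ : ∀ {m n r : ℕ} (h : r + 1 = m + n) (i : Fin m) (x : P.carrier m) (y : P.carrier n),
    app r (P.circ h i x y) = Q.circ h i (app m x) (app n y)

/-- Composition of morphisms of operads. -/
def Hom.comp {P : SymmOperad.{u, w} k} {Q : SymmOperad.{u, w'} k}
    {R : SymmOperad.{u, v} k} (g : Hom Q R) (f : Hom P Q) : Hom P R where
  app n := (g.app n).comp (f.app n)
  app_act σ x := by simp [f.app_act, g.app_act]
  app_one := by simp [f.app_one, g.app_one]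
  app_circ h i x y := by simp [f.app_circ, g.app_circ]

/-- An operadic ideal. -/
structure OpIdeal (P : SymmOperad.{u, w} k) where
  /-- the elements of arity `n` -/
  sub : ∀ n, Submodule k (P.carrier n)
  act_mem : ∀ {n : ℕ} (σ : Equiv.Perm (Fin n)) {x : P.carrier n}, x ∈ sub n → P.act σ x ∈ sub n
  circ_mem_left : ∀ {m n r : ℕ} (h : r + 1 = m + n) (i : Fin m) {x : P.carrier m}
    (y : P.carrier n), x ∈ sub m → P.circ h i x y ∈ sub r
  circ_mem_right : ∀ {m n r : ℕ} (h : r + 1 = m + n) (i : Fin m) (x : P.carrier m)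
    {y : P.carrier n}, y ∈ sub n → P.circ h i x y ∈ sub r

/-- The operadic ideal generated by a set of operations (of any arities): the intersection of all
operadic ideals that contain it. -/
def OpIdeal.span (P : SymmOperad.{u, w} k) (R : Set (Σ n, P.carrier n)) : OpIdeal P where
  sub n := sInf {A | ∃ I : OpIdeal P, (∀ x ∈ R, x.2 ∈ I.sub x.1) ∧ A = I.sub n}
  act_mem σ x hx := by
    rw [Submodule.mem_sInf] at hx ⊢
    rintro _ ⟨I, hI, rfl⟩
    exact I.act_mem σ (hx _ ⟨I, hI, rfl⟩)
  circ_mem_left h i x y hx := by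
    rw [Submodule.mem_sInf] at hx ⊢
    rintro _ ⟨I, hI, rfl⟩
    exact I.circ_mem_left h i y (hx _ ⟨I, hI, rfl⟩)
  circ_mem_right h i x y hy := by
    rw [Submodule.mem_sInf] at hy ⊢
    rintro _ ⟨I, hI, rfl⟩
    exact I.circ_mem_right h i x (hy _ ⟨I, hI, rfl⟩)

/-- The partial composition of a quotient operad. -/
def quotCirc (P : SymmOperad.{u, w} k) (I : OpIdeal P) {m n r : ℕ} (h : r + 1 = m + n)
    (i : Fin m) : (P.carrier m ⧸ I.sub m) →ₗ[k] (P.carrier n ⧸ I.sub n) →ₗ[k]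
      (P.carrier r ⧸ I.sub r) :=
  (I.sub m).liftQ
    { toFun := fun x => (I.sub n).mapQ (I.sub r) (P.circ h i x)
        (fun _ hy => I.circ_mem_right h i x hy)
      map_add' := fun x y => by
        apply LinearMap.ext
        rintro ⟨z⟩
        simp [Submodule.Quotient.quot_mk_eq_mk]
      map_smul' := fun c x => by
        apply LinearMap.ext
        rintro ⟨z⟩
        simp [Submodule.Quotient.quot_mk_eq_mk] }
    (fun x hx => by
      rw [LinearMap.mem_ker]
      apply LinearMap.ext
      rintro ⟨z⟩
      simpa [Submodule.Quotient.quot_mk_eq_mk] using I.circ_mem_left h i z hx)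

/-- The quotient of an operad by an operadic ideal. -/
def quot (P : SymmOperad.{u, w} k) (I : OpIdeal P) : SymmOperad.{u, w} k where
  carrier n := P.carrier n ⧸ I.sub n
  act {n} σ := (I.sub n).mapQ (I.sub n) (P.act σ) (fun _ hx => I.act_mem σ hx)
  one := (I.sub 1).mkQ P.one
  circ h i := quotCirc P I h i
  reduced := by
    have := P.reduced
    infer_instance
  act_one := by
    rintro n ⟨x⟩
    exact congrArg (I.sub n).mkQ (P.act_one x)
  act_mul := by
    rintro n σ τ ⟨x⟩
    exact congrArg (I.sub n).mkQ (P.act_mul σ τ x)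
  one_circ := by
    rintro n h i ⟨x⟩
    exact congrArg (I.sub n).mkQ (P.one_circ h i x)
  circ_one := by
    rintro n h i ⟨x⟩
    exact congrArg (I.sub n).mkQ (P.circ_one h i x)
  circ_seq := by
    rintro l m n r s t h₁ h₂ h₃ h₄ i j ⟨x⟩ ⟨y⟩ ⟨z⟩
    exact congrArg (I.sub t).mkQ (P.circ_seq h₁ h₂ h₃ h₄ i j x y z)
  circ_par := by
    rintro l m n r s t h₁ h₂ h₃ h₄ i j hij ⟨x⟩ ⟨y⟩ ⟨z⟩
    exact congrArg (I.sub t).mkQ (P.circ_par h₁ h₂ h₃ h₄ i j hij x y z)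
  act_circ := by
    rintro m n r h i σ σ' ⟨x⟩ ⟨y⟩ h₁ h₂
    exact congrArg (I.sub r).mkQ (P.act_circ h i σ σ' x y h₁ h₂)
  circ_act := by
    rintro m n r h i τ τ' ⟨x⟩ ⟨y⟩ h₁ h₂
    exact congrArg (I.sub r).mkQ (P.circ_act h i τ τ' x y h₁ h₂)

/-- The canonical projection onto a quotient operad. -/
def proj (P : SymmOperad.{u, w} k) (I : OpIdeal P) : Hom P (P.quot I) where
  app n := (I.sub n).mkQ
  app_act _ _ := rfl
  app_one := rfl
  app_circ _ _ _ _ := rfl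

end SymmOperad

/-! ## Free operads on unary and binary generators -/

/-- A basis of an `𝕊`-module `W = W₁ ⊕ W₂` of unary and binary generators, where the basis of `W₂`
is stable under the transposition `(12)`; `swap θ` is `θ' = θ^{(12)}`. The identity operation is
not listed among the unary generators. -/
structure Gens where
  /-- unary generators -/
  una : Type v
  /-- binary generators -/
  bin : Type v
  /-- the action of `(12)` on binary generators -/
  swap : bin → bin
  swap_swap : ∀ b, swap (swap b) = b

/-- Trees with unary and binary vertices labelled by generators, and leaves labelled by `X`. -/
inductive Tree (W : Gens.{v}) (X : Type) : Type v
  | leaf (x : X) : Tree W X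
  | una (ω : W.una) (s : Tree W X) : Tree W X
  | bin (θ : W.bin) (s t : Tree W X) : Tree W X

namespace Tree

variable {W W₁ : Gens.{v}} {X Y Z : Type}

/-- Grafting: replace every leaf `x` by the tree `f x`. -/
def bind : Tree W X → (X → Tree W Y) → Tree W Y
  | leaf x, f => f x
  | una ω s, f => una ω (s.bind f)
  | bin θ s t, f => bin θ (s.bind f) (t.bind f)

/-- Relabelling of the leaves. -/
def map (f : X → Y) (s : Tree W X) : Tree W Y := s.bind (fun x => leaf (f x))

/-- The labels of the leaves, from left to right. -/
def leaves : Tree W X → List X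
  | leaf x => [x]
  | una _ s => s.leaves
  | bin _ s t => s.leaves ++ t.leaves

/-- The tree has exactly `n` leaves, which carry the labels `0, …, n - 1` (once each). -/
def Linear {n : ℕ} (s : Tree W (Fin n)) : Prop := s.leaves.Perm (List.finRange n)

/-- Two trees denote the same operation of the free operad: they differ by replacing, at some binary
vertices, `θ(s, t)` by `θ'(t, s)`. -/
inductive Rel : Tree W X → Tree W X → Prop
  | leaf (x : X) : Rel (leaf x) (leaf x)
  | una (ω : W.una) {s s' : Tree W X} : Rel s s' → Rel (una ω s) (una ω s')
  | bin (θ : W.bin) {s s' t t' : Tree W X} : Rel s s' → Rel t t' → Rel (bin θ s t) (bin θ s' t')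
  | swap (θ : W.bin) {s s' t t' : Tree W X} :
      Rel s s' → Rel t t' → Rel (bin θ s t) (bin (W.swap θ) t' s')

theorem Rel.refl (s : Tree W X) : Rel s s := by
  induction s with
  | leaf x => exact .leaf x
  | una ω s ih => exact .una ω ih
  | bin θ s t ihs iht => exact .bin θ ihs iht

theorem Rel.symm {s t : Tree W X} (h : Rel s t) : Rel t s := by
  induction h with
  | leaf x => exact .leaf x
  | una ω _ ih => exact .una ω ih
  | bin θ _ _ ihs iht => exact .bin θ ihs iht
  | swap θ _ _ ihs iht =>
    have := Rel.swap (W.swap θ) iht ihs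
    rwa [W.swap_swap] at this

theorem Rel.trans {s t r : Tree W X} (h : Rel s t) (h' : Rel t r) : Rel s r := by
  induction h generalizing r with
  | leaf x => exact h'
  | una ω _ ih =>
    cases h' with
    | una _ h' => exact .una ω (ih h')
  | bin θ _ _ ihs iht =>
    cases h' with
    | bin _ h₁ h₂ => exact .bin θ (ihs h₁) (iht h₂)
    | swap _ h₁ h₂ => exact .swap θ (ihs h₁) (iht h₂)
  | swap θ _ _ ihs iht =>
    cases h' with
    | bin _ h₁ h₂ => exact .swap θ (ihs h₂) (iht h₁)
    | swap _ h₁ h₂ =>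
      rw [W.swap_swap]
      exact .bin θ (ihs h₂) (iht h₁)

theorem Rel.bind {s t : Tree W X} (h : Rel s t) {f g : X → Tree W Y} (hfg : ∀ x, Rel (f x) (g x)) :
    Rel (s.bind f) (t.bind g) := by
  induction h with
  | leaf x => exact hfg x
  | una ω _ ih => exact .una ω ih
  | bin θ _ _ ihs iht => exact .bin θ ihs iht
  | swap θ _ _ ihs iht => exact .swap θ ihs iht

theorem Rel.map {s t : Tree W X} (h : Rel s t) (f : X → Y) : Rel (s.map f) (t.map f) :=
  h.bind (fun x => .leaf (f x))

theorem bind_bind (s : Tree W X) (f : X → Tree W Y) (g : Y → Tree W Z) :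
    (s.bind f).bind g = s.bind (fun x => (f x).bind g) := by
  induction s with
  | leaf x => rfl
  | una ω s ih => simp [Tree.bind, ih]
  | bin θ s t ihs iht => simp [Tree.bind, ihs, iht]

theorem bind_leaf (s : Tree W X) : s.bind leaf = s := by
  induction s with
  | leaf x => rfl
  | una ω s ih => simp [Tree.bind, ih]
  | bin θ s t ihs iht => simp [Tree.bind, ihs, iht]

theorem leaves_bind (s : Tree W X) (f : X → Tree W Y) :
    (s.bind f).leaves = s.leaves.flatMap (fun x => (f x).leaves) := by
  induction s with
  | leaf x => simp [Tree.bind, leaves]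
  | una ω s ih => simp [Tree.bind, leaves, ih]
  | bin θ s t ihs iht => simp [Tree.bind, leaves, ihs, iht]

theorem leaves_map (s : Tree W X) (f : X → Y) : (s.map f).leaves = s.leaves.map f := by
  induction s with
  | leaf x => rfl
  | una ω s ih => exact ih
  | bin θ s t ihs iht =>
    rw [leaves, List.map_append, ← ihs, ← iht]
    rfl

theorem leaves_ne_nil (s : Tree W X) : s.leaves ≠ [] := by
  induction s with
  | leaf x => simp [leaves]
  | una ω s ih => simpa [leaves] using ih
  | bin θ s t ihs iht => simp [leaves, ihs]

theorem linear_iff {n : ℕ} (s : Tree W (Fin n)) :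
    s.Linear ↔ s.leaves.Nodup ∧ ∀ i, i ∈ s.leaves := by
  constructor
  · intro h
    exact ⟨h.nodup_iff.2 (List.nodup_finRange n), fun i => h.mem_iff.2 (List.mem_finRange i)⟩
  · rintro ⟨h₁, h₂⟩
    exact (List.perm_ext_iff_of_nodup h₁ (List.nodup_finRange n)).2 (by simp [h₂])

theorem Linear.of {n : ℕ} {s : Tree W (Fin n)} (l : List (Fin n)) (h : s.leaves = l)
    (hl : l.Perm (List.finRange n)) : s.Linear := by
  rw [Linear, h]
  exact hl

theorem Linear.map {n : ℕ} {s : Tree W (Fin n)} (hs : s.Linear) (σ : Equiv.Perm (Fin n)) :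
    (s.map σ).Linear := by
  rw [linear_iff] at hs ⊢
  rw [leaves_map]
  refine ⟨hs.1.map σ.injective, fun i => ?_⟩
  rw [List.mem_map]
  exact ⟨σ.symm i, hs.2 _, by simp⟩

/-- The leaf `i` of `s` is replaced by `t`, and the leaves are renumbered. -/
def graft {m n r : ℕ} (h : r + 1 = m + n) (i : Fin m) (s : Tree W (Fin m)) (t : Tree W (Fin n)) :
    Tree W (Fin r) :=
  s.bind (fun x => if hx : x = i then t.map (inPos h i) else leaf (outPos h i x hx))

end Tree

theorem perm_inv_apply {n : ℕ} (σ : Equiv.Perm (Fin n)) (x : Fin n) : σ⁻¹ (σ x) = x :=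
  σ.symm_apply_apply x

theorem inPos_inj {m n r : ℕ} (h : r + 1 = m + n) (i : Fin m) {x y : Fin n}
    (e : inPos h i x = inPos h i y) : x = y := by
  simp only [inPos, Fin.mk.injEq] at e
  exact Fin.ext (by omega)

theorem outPos_inj {m n r : ℕ} (h : r + 1 = m + n) (i : Fin m) {x y : Fin m} (hx : x ≠ i)
    (hy : y ≠ i) (e : outPos h i x hx = outPos h i y hy) : x = y := by
  have h₁ : x.1 ≠ i.1 := fun e => hx (Fin.ext e)
  have h₂ : y.1 ≠ i.1 := fun e => hy (Fin.ext e)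
  simp only [outPos, Fin.mk.injEq] at e
  refine Fin.ext ?_
  split at e <;> split at e <;> omega

theorem inPos_ne_outPos {m n r : ℕ} (h : r + 1 = m + n) (i : Fin m) (y : Fin n) {x : Fin m}
    (hx : x ≠ i) : inPos h i y ≠ outPos h i x hx := by
  have h₁ : x.1 ≠ i.1 := fun e => hx (Fin.ext e)
  simp only [inPos, outPos, ne_eq, Fin.mk.injEq]
  split <;> omega

theorem pos_cases {m n r : ℕ} (h : r + 1 = m + n) (i : Fin m) (p : Fin r) :
    (∃ y, p = inPos h i y) ∨ ∃ x, ∃ hx : x ≠ i, p = outPos h i x hx := by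
  by_cases h₁ : p.1 < i.1
  · refine .inr ⟨⟨p.1, by omega⟩, fun e => ?_, ?_⟩
    · rw [Fin.ext_iff] at e
      simp only at e
      omega
    · simp [outPos, h₁]
  · by_cases h₂ : p.1 < i.1 + n
    · refine .inl ⟨⟨p.1 - i.1, by omega⟩, ?_⟩
      simp only [inPos, Fin.ext_iff]
      omega
    · refine .inr ⟨⟨p.1 + 1 - n, by omega⟩, fun e => ?_, ?_⟩
      · rw [Fin.ext_iff] at e
        simp only at e
        omega
      · simp only [outPos, Fin.ext_iff]
        split <;> omega

namespace Tree

variable {W W₁ : Gens.{v}} {X Y Z : Type}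

theorem Linear.graft {m n r : ℕ} (h : r + 1 = m + n) (i : Fin m) {s : Tree W (Fin m)}
    {t : Tree W (Fin n)} (hs : s.Linear) (ht : t.Linear) : (graft h i s t).Linear := by
  rw [linear_iff] at hs ht ⊢
  rw [Tree.graft, leaves_bind]
  constructor
  · rw [List.nodup_flatMap]
    constructor
    · intro x _
      split
      · rw [leaves_map]
        exact ht.1.map (fun _ _ => inPos_inj h i)
      · simp [leaves]
    · refine hs.1.imp_of_mem ?_
      intro a b _ _ hab
      simp only [Function.onFun, List.disjoint_left]
      intro p hp hp'
      split at hp <;> split at hp'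
      · exact hab (by simp_all)
      · rw [leaves_map, List.mem_map] at hp
        obtain ⟨y, _, rfl⟩ := hp
        simp only [leaves, List.mem_singleton] at hp'
        exact inPos_ne_outPos _ _ _ _ hp'
      · rw [leaves_map, List.mem_map] at hp'
        obtain ⟨y, _, rfl⟩ := hp'
        simp only [leaves, List.mem_singleton] at hp
        exact inPos_ne_outPos _ _ _ _ hp
      · simp only [leaves, List.mem_singleton] at hp hp'
        exact hab (outPos_inj h i _ _ (hp.symm.trans hp'))
  · intro p
    rw [List.mem_flatMap]
    rcases pos_cases h i p with ⟨y, rfl⟩ | ⟨x, hx, rfl⟩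
    · refine ⟨i, hs.2 i, ?_⟩
      simp only [dite_true, leaves_map, List.mem_map]
      exact ⟨y, ht.2 y, rfl⟩
    · exact ⟨x, hs.2 x, by simp [hx, leaves]⟩

theorem Rel.graft {m n r : ℕ} (h : r + 1 = m + n) (i : Fin m) {s s' : Tree W (Fin m)}
    {t t' : Tree W (Fin n)} (hs : Rel s s') (ht : Rel t t') :
    Rel (graft h i s t) (graft h i s' t') := by
  refine hs.bind (fun x => ?_)
  by_cases hx : x = i
  · simpa [hx] using ht.map _
  · simpa [hx] using Rel.refl _

end Tree

/-- Trees with leaves `0, …, n - 1`, up to `θ(s, t) = θ'(t, s)`. -/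
def treeSetoid (W : Gens.{v}) (n : ℕ) : Setoid {s : Tree W (Fin n) // s.Linear} where
  r s t := Tree.Rel s.1 t.1
  iseqv := ⟨fun s => .refl s.1, fun h => h.symm, fun h h' => h.trans h'⟩

/-- The tree monomials of arity `n`: a basis of the arity `n` part of the free operad. -/
def Mon (W : Gens.{v}) (n : ℕ) : Type v := Quotient (treeSetoid W n)

namespace Mon

variable {W W₁ : Gens.{v}}

/-- The monomial of a tree. -/
def mk {n : ℕ} (s : Tree W (Fin n)) (hs : s.Linear) : Mon W n := Quotient.mk _ ⟨s, hs⟩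

theorem mk_eq {n : ℕ} {s t : Tree W (Fin n)} (hs : s.Linear) (ht : t.Linear) (h : Tree.Rel s t) :
    mk s hs = mk t ht := Quotient.sound h

theorem mk_congr {n : ℕ} {s t : Tree W (Fin n)} (hs : s.Linear) (ht : t.Linear) (h : s = t) :
    mk s hs = mk t ht := by subst h; rfl

theorem ind {n : ℕ} {p : Mon W n → Prop} (h : ∀ s hs, p (mk s hs)) (a : Mon W n) : p a :=
  Quotient.ind (fun s => h s.1 s.2) a

/-- The right action of permutations: the variable `x_a` is replaced by `x_{σ⁻¹ a}`. -/
def act {n : ℕ} (σ : Equiv.Perm (Fin n)) : Mon W n → Mon W n :=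
  Quotient.lift (fun s => mk (s.1.map ⇑σ⁻¹) (s.2.map σ⁻¹))
    (fun _ _ h => mk_eq _ _ (Tree.Rel.map h _))

/-- Partial composition of monomials, by grafting. -/
def circ {m n r : ℕ} (h : r + 1 = m + n) (i : Fin m) : Mon W m → Mon W n → Mon W r :=
  Quotient.lift₂ (fun s t => mk (Tree.graft h i s.1 t.1) (s.2.graft h i t.2))
    (fun _ _ _ _ hs ht => mk_eq _ _ (Tree.Rel.graft h i hs ht))

theorem act_one {n : ℕ} (a : Mon W n) : act 1 a = a := by
  induction a using ind with
  | h s hs => exact mk_congr _ _ (Tree.bind_leaf s)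

theorem act_mul {n : ℕ} (σ τ : Equiv.Perm (Fin n)) (a : Mon W n) :
    act (σ * τ) a = act τ (act σ a) := by
  induction a using ind with
  | h s hs =>
    refine mk_congr _ _ ?_
    simp [Tree.map, Tree.bind_bind, Tree.bind]

theorem one_circ {n : ℕ} (h : n + 1 = 1 + n) (i : Fin 1) (hl) (a : Mon W n) :
    circ h i (mk (.leaf 0) hl) a = a := by
  induction a using ind with
  | h s hs =>
    refine mk_congr _ _ ?_
    obtain rfl : i = 0 := Subsingleton.elim _ _
    have : ∀ x, inPos h 0 x = x := fun x => Fin.ext (by simp [inPos])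
    simp [Tree.graft, Tree.bind, Tree.map, this, Tree.bind_leaf]

theorem circ_one {n : ℕ} (h : n + 1 = n + 1) (i : Fin n) (hl) (a : Mon W n) :
    circ h i a (mk (.leaf 0) hl) = a := by
  induction a using ind with
  | h s hs =>
    refine mk_congr _ _ ?_
    conv_rhs => rw [← Tree.bind_leaf s]
    rw [Tree.graft]
    congr 1
    funext x
    by_cases hx : x = i
    · subst hx
      simp [Tree.map, Tree.bind, inPos]
    · simp [hx, outPos]

theorem circ_seq {l m n r s t : ℕ} (h₁ : r + 1 = l + m) (h₂ : t + 1 = r + n) (h₃ : s + 1 = m + n)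
    (h₄ : t + 1 = l + s) (i : Fin l) (j : Fin m) (a : Mon W l) (b : Mon W m) (c : Mon W n) :
    circ h₂ (inPos h₁ i j) (circ h₁ i a b) c = circ h₄ i a (circ h₃ j b c) := by
  induction a using ind with
  | h a ha =>
  induction b using ind with
  | h b hb =>
  induction c using ind with
  | h c hc =>
    refine mk_congr _ _ ?_
    simp only [Tree.graft, Tree.bind_bind, Tree.map]
    congr 1
    funext x
    by_cases hx : x = i
    · subst hx
      simp only [dite_true, Tree.bind_bind]
      congr 1
      funext y
      by_cases hy : y = j
      · subst hy
        simp only [Tree.bind, dite_true, Tree.bind_bind]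
        congr 1
        funext z
        simp only [Tree.leaf.injEq, inPos, Fin.mk.injEq]
        omega
      · have : inPos h₁ x y ≠ inPos h₁ x j := fun e => hy (inPos_inj _ _ e)
        simp only [Tree.bind, hy, this, dite_false, Tree.leaf.injEq]
        simp only [inPos, outPos, Fin.mk.injEq]
        have : y.1 ≠ j.1 := fun e => hy (Fin.ext e)
        by_cases hlt : y.1 < j.1
        · simp [hlt]
        · simp only [hlt, if_false, Nat.add_lt_add_iff_left]
          omega
    · have : outPos h₁ i x hx ≠ inPos h₁ i j := (inPos_ne_outPos h₁ i j hx).symm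
      simp only [Tree.bind, hx, this, dite_false, Tree.leaf.injEq]
      simp only [inPos, outPos, Fin.mk.injEq]
      have : x.1 ≠ i.1 := fun e => hx (Fin.ext e)
      split_ifs <;> omega

theorem circ_par {l m n r s t : ℕ} (h₁ : r + 1 = l + m) (h₂ : t + 1 = r + n) (h₃ : s + 1 = l + n)
    (h₄ : t + 1 = s + m) (i j : Fin l) (hij : i < j) (a : Mon W l) (b : Mon W m) (c : Mon W n) :
    circ h₂ (outPos h₁ i j hij.ne') (circ h₁ i a b) c =
      circ h₄ (outPos h₃ j i hij.ne) (circ h₃ j a c) b := by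
  induction a using ind with
  | h a ha =>
  induction b using ind with
  | h b hb =>
  induction c using ind with
  | h c hc =>
    have hij' : i.1 < j.1 := hij
    refine mk_congr _ _ ?_
    simp only [Tree.graft, Tree.bind_bind, Tree.map]
    congr 1
    funext x
    by_cases hx : x = i
    · subst hx
      simp only [dite_true, hij.ne, dite_false, Tree.bind_bind, Tree.bind]
      congr 1
      funext y
      have : inPos h₁ x y ≠ outPos h₁ x j hij.ne' := inPos_ne_outPos _ _ _ _
      simp only [this, dite_false, Tree.leaf.injEq]
      simp only [inPos, outPos, Fin.mk.injEq]
      split_ifs <;> omega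
    · by_cases hx' : x = j
      · subst hx'
        simp only [dite_true, hij.ne', dite_false, Tree.bind_bind, Tree.bind]
        congr 1
        funext y
        have : inPos h₃ x y ≠ outPos h₃ x i hij.ne := inPos_ne_outPos _ _ _ _
        simp only [this, dite_false, Tree.leaf.injEq]
        simp only [inPos, outPos, Fin.mk.injEq]
        split_ifs <;> omega
      · have e₁ : outPos h₁ i x hx ≠ outPos h₁ i j hij.ne' := fun e => hx' (outPos_inj _ _ _ _ e)
        have e₂ : outPos h₃ j x hx' ≠ outPos h₃ j i hij.ne := fun e => hx (outPos_inj _ _ _ _ e)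
        simp only [Tree.bind, hx, hx', e₁, e₂, dite_false, Tree.leaf.injEq]
        simp only [outPos, Fin.mk.injEq]
        have : x.1 ≠ i.1 := fun e => hx (Fin.ext e)
        have : x.1 ≠ j.1 := fun e => hx' (Fin.ext e)
        split_ifs <;> omega

theorem act_circ {m n r : ℕ} (h : r + 1 = m + n) (i : Fin m) (σ : Equiv.Perm (Fin m))
    (σ' : Equiv.Perm (Fin r)) (a : Mon W m) (b : Mon W n)
    (h₁ : ∀ b, σ' (inPos h i b) = inPos h (σ i) b)
    (h₂ : ∀ a (ha : a ≠ i),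
      σ' (outPos h i a ha) = outPos h (σ i) (σ a) (fun e => ha (σ.injective e))) :
    circ h i (act σ a) b = act σ' (circ h (σ i) a b) := by
  induction a using ind with
  | h a ha =>
  induction b using ind with
  | h b hb =>
    refine mk_congr _ _ ?_
    simp only [Tree.graft, Tree.bind_bind, Tree.map]
    congr 1
    funext x
    obtain ⟨x, rfl⟩ := σ.surjective x
    by_cases hx : x = i
    · subst hx
      simp only [Tree.bind, perm_inv_apply, dite_true, Tree.bind_bind]
      congr 1
      funext y
      rw [← h₁ y, perm_inv_apply]
    · have : σ x ≠ σ i := fun e => hx (σ.injective e)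
      simp only [Tree.bind, perm_inv_apply, hx, this, dite_false]
      rw [← h₂ x hx]
      exact congrArg Tree.leaf (perm_inv_apply σ' _).symm

theorem circ_act {m n r : ℕ} (h : r + 1 = m + n) (i : Fin m) (τ : Equiv.Perm (Fin n))
    (τ' : Equiv.Perm (Fin r)) (a : Mon W m) (b : Mon W n)
    (h₁ : ∀ b, τ' (inPos h i b) = inPos h i (τ b))
    (h₂ : ∀ a (ha : a ≠ i), τ' (outPos h i a ha) = outPos h i a ha) :
    circ h i a (act τ b) = act τ' (circ h i a b) := by
  induction a using ind with
  | h a ha =>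
  induction b using ind with
  | h b hb =>
    refine mk_congr _ _ ?_
    simp only [Tree.graft, Tree.bind_bind, Tree.map]
    congr 1
    funext x
    by_cases hx : x = i
    · subst hx
      simp only [Tree.bind, dite_true, Tree.bind_bind]
      congr 1
      funext y
      obtain ⟨y, rfl⟩ := τ.surjective y
      rw [← h₁ y, perm_inv_apply, perm_inv_apply]
    · simp only [Tree.bind, hx, dite_false]
      conv_rhs => rw [← h₂ x hx, perm_inv_apply]

end Mon

noncomputable section

/-- The partial composition of the free operad: the bilinear extension of grafting. -/
def freeCirc (k : Type u) [Field k] (W : Gens.{v}) {m n r : ℕ} (h : r + 1 = m + n) (i : Fin m) :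
    (Mon W m →₀ k) →ₗ[k] (Mon W n →₀ k) →ₗ[k] (Mon W r →₀ k) :=
  Finsupp.linearCombination k (fun a => Finsupp.lmapDomain k k (Mon.circ h i a))

theorem freeCirc_single (k : Type u) [Field k] (W : Gens.{v}) {m n r : ℕ} (h : r + 1 = m + n)
    (i : Fin m) (a : Mon W m) (b : Mon W n) (c d : k) :
    freeCirc k W h i (Finsupp.single a c) (Finsupp.single b d) =
      Finsupp.single (Mon.circ h i a b) (c * d) := by
  simp [freeCirc, Finsupp.linearCombination_single, Finsupp.lmapDomain_apply,
    Finsupp.mapDomain_single]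

/-- The free operad `F(W)`: its arity `n` part is the space with basis the tree monomials of
arity `n`. -/
def free (k : Type u) [Field k] (W : Gens.{v}) : SymmOperad.{u, max u v} k where
  carrier n := Mon W n →₀ k
  act σ := Finsupp.lmapDomain k k (Mon.act σ)
  one := Finsupp.single (Mon.mk (.leaf 0) (.of [0] rfl (by decide))) 1
  circ h i := freeCirc k W h i
  reduced := by
    have : IsEmpty (Mon W 0) := ⟨fun a => by
      induction a using Mon.ind with
      | h s hs => exact s.leaves_ne_nil (List.Perm.eq_nil hs)⟩
    infer_instance
  act_one {n} x := by
    have : (Mon.act 1 : Mon W n → Mon W n) = id := funext Mon.act_one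
    simp [this]
  act_mul {n} σ τ x := by
    have : (Mon.act (σ * τ) : Mon W n → Mon W n) = Mon.act τ ∘ Mon.act σ :=
      funext (Mon.act_mul σ τ)
    simp [Finsupp.lmapDomain_apply, this, Finsupp.mapDomain_comp]
  one_circ h i x := by
    induction x using Finsupp.induction_linear with
    | zero => simp
    | add x y hx hy => rw [map_add, hx, hy]
    | single a c => rw [freeCirc_single, Mon.one_circ, one_mul]
  circ_one h i x := by
    induction x using Finsupp.induction_linear with
    | zero => simp
    | add x y hx hy => rw [map_add, LinearMap.add_apply, hx, hy]
    | single a c => rw [freeCirc_single, Mon.circ_one, mul_one]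
  circ_seq h₁ h₂ h₃ h₄ i j x y z := by
    induction x using Finsupp.induction_linear with
    | zero => simp
    | add x x' hx hx' => simp only [map_add, LinearMap.add_apply, hx, hx']
    | single a c =>
    induction y using Finsupp.induction_linear with
    | zero => simp
    | add y y' hy hy' => simp only [map_add, LinearMap.add_apply, hy, hy']
    | single b d =>
    induction z using Finsupp.induction_linear with
    | zero => simp
    | add z z' hz hz' => simp only [map_add, hz, hz']
    | single e f => simp only [freeCirc_single, Mon.circ_seq h₁ h₂ h₃ h₄, mul_assoc]
  circ_par h₁ h₂ h₃ h₄ i j hij x y z := by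
    induction x using Finsupp.induction_linear with
    | zero => simp
    | add x x' hx hx' => simp only [map_add, LinearMap.add_apply, hx, hx']
    | single a c =>
    induction y using Finsupp.induction_linear with
    | zero => simp
    | add y y' hy hy' => simp only [map_add, LinearMap.add_apply, hy, hy']
    | single b d =>
    induction z using Finsupp.induction_linear with
    | zero => simp
    | add z z' hz hz' => simp only [map_add, LinearMap.add_apply, hz, hz']
    | single e f =>
      simp only [freeCirc_single, Mon.circ_par h₁ h₂ h₃ h₄ i j hij, mul_right_comm]
  act_circ h i σ σ' x y h₁ h₂ := by
    induction x using Finsupp.induction_linear with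
    | zero => simp
    | add x x' hx hx' => simp only [map_add, LinearMap.add_apply, hx, hx']
    | single a c =>
    induction y using Finsupp.induction_linear with
    | zero => simp
    | add y y' hy hy' => simp only [map_add, hy, hy']
    | single b d =>
      simp only [Finsupp.lmapDomain_apply, Finsupp.mapDomain_single, freeCirc_single,
        Mon.act_circ h i σ σ' a b h₁ h₂]
  circ_act h i τ τ' x y h₁ h₂ := by
    induction x using Finsupp.induction_linear with
    | zero => simp
    | add x x' hx hx' => simp only [map_add, LinearMap.add_apply, hx, hx']
    | single a c =>
    induction y using Finsupp.induction_linear with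
    | zero => simp
    | add y y' hy hy' => simp only [map_add, hy, hy']
    | single b d =>
      simp only [Finsupp.lmapDomain_apply, Finsupp.mapDomain_single, freeCirc_single,
        Mon.circ_act h i τ τ' a b h₁ h₂]

/-- A tree, as an element of the free operad. -/
def tr (k : Type u) [Field k] {W : Gens.{v}} {n : ℕ} (s : Tree W (Fin n)) (hs : s.Linear) :
    (free k W).carrier n :=
  Finsupp.single (Mon.mk s hs) (1 : k)

/-- The operad `P(W, R) = F(W)/(R)` presented by generators and relators. -/
def presented (k : Type u) [Field k] (W : Gens.{v}) (R : Set (Σ n, (free k W).carrier n)) :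
    SymmOperad.{u, max u v} k :=
  (free k W).quot (.span (free k W) R)

/-- The class of a tree in a presented operad. -/
def trClass (k : Type u) [Field k] {W : Gens.{v}} (R : Set (Σ n, (free k W).carrier n)) {n : ℕ}
    (s : Tree W (Fin n)) (hs : s.Linear) : (presented k W R).carrier n :=
  ((free k W).proj (.span (free k W) R)).app n (tr k s hs)

/-! ## Morphisms of free operads that send generators to tree monomials -/

/-- An equivariant assignment of tree monomials (of the same arity) to generators. -/
structure GenMap (V W : Gens.{v}) where
  /-- images of unary generators -/
  una : V.una → Tree W (Fin 1)
  /-- images of binary generators -/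
  bin : V.bin → Tree W (Fin 2)
  una_linear : ∀ ω, (una ω).Linear
  bin_linear : ∀ θ, (bin θ).Linear
  bin_swap : ∀ θ, Tree.Rel (bin (V.swap θ)) ((bin θ).map (Equiv.swap 0 1))

namespace GenMap

variable {V W : Gens.{v}} {X Y : Type}

/-- Substitute the images of the generators into a tree. -/
def subst (g : GenMap V W) : Tree V X → Tree W X
  | .leaf x => .leaf x
  | .una ω s => (g.una ω).bind (fun _ => g.subst s)
  | .bin θ s t => (g.bin θ).bind ![g.subst s, g.subst t]

theorem subst_bind (g : GenMap V W) (s : Tree V X) (f : X → Tree V Y) :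
    g.subst (s.bind f) = (g.subst s).bind (fun x => g.subst (f x)) := by
  induction s with
  | leaf x => rfl
  | una ω s ih => simp [Tree.bind, subst, ih, Tree.bind_bind]
  | bin θ s t ihs iht =>
    simp only [Tree.bind, subst, ihs, iht, Tree.bind_bind]
    congr 1
    funext x
    fin_cases x <;> rfl

theorem subst_map (g : GenMap V W) (s : Tree V X) (f : X → Y) :
    g.subst (s.map f) = (g.subst s).map f := subst_bind g s _

theorem leaves_subst (g : GenMap V W) (s : Tree V X) : (g.subst s).leaves.Perm s.leaves := by
  induction s with
  | leaf x => exact .refl _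
  | una ω s ih =>
    rw [subst, Tree.leaves_bind]
    refine ((g.una_linear ω).flatMap_right _).trans ?_
    simpa [Tree.leaves, List.finRange_succ] using ih
  | bin θ s t ihs iht =>
    rw [subst, Tree.leaves_bind]
    refine ((g.bin_linear θ).flatMap_right _).trans ?_
    simpa [Tree.leaves, List.finRange_succ] using ihs.append iht

theorem subst_linear (g : GenMap V W) {n : ℕ} {s : Tree V (Fin n)} (hs : s.Linear) :
    (g.subst s).Linear := (g.leaves_subst s).trans hs

theorem subst_rel (g : GenMap V W) {s t : Tree V X} (h : Tree.Rel s t) :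
    Tree.Rel (g.subst s) (g.subst t) := by
  induction h with
  | leaf x => exact .leaf x
  | una ω _ ih => exact (Tree.Rel.refl _).bind (fun _ => ih)
  | bin θ _ _ ihs iht =>
    refine (Tree.Rel.refl _).bind (fun x => ?_)
    fin_cases x
    · exact ihs
    · exact iht
  | @swap θ s s' t t' _ _ ihs iht =>
    refine Tree.Rel.trans ?_ ((g.bin_swap θ).bind (fun x => Tree.Rel.refl _)).symm
    rw [Tree.map, Tree.bind_bind]
    refine (Tree.Rel.refl _).bind (fun x => ?_)
    fin_cases x
    · exact ihs
    · exact iht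

/-- The induced map on tree monomials. -/
def onMon (g : GenMap V W) {n : ℕ} : Mon V n → Mon W n :=
  Quotient.lift (fun s => Mon.mk (g.subst s.1) (g.subst_linear s.2))
    (fun _ _ h => Mon.mk_eq _ _ (g.subst_rel h))

theorem onMon_act (g : GenMap V W) {n : ℕ} (σ : Equiv.Perm (Fin n)) (a : Mon V n) :
    g.onMon (Mon.act σ a) = Mon.act σ (g.onMon a) := by
  induction a using Mon.ind with
  | h s hs => exact Mon.mk_congr _ _ (g.subst_map s _)

theorem onMon_circ (g : GenMap V W) {m n r : ℕ} (h : r + 1 = m + n) (i : Fin m) (a : Mon V m)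
    (b : Mon V n) : g.onMon (Mon.circ h i a b) = Mon.circ h i (g.onMon a) (g.onMon b) := by
  induction a using Mon.ind with
  | h s hs =>
  induction b using Mon.ind with
  | h t ht =>
    refine Mon.mk_congr _ _ ?_
    simp only [Tree.graft, subst_bind]
    congr 1
    funext x
    by_cases hx : x = i
    · simp [hx, subst_map]
    · simp [hx, subst]

theorem lmapDomain_circ (k : Type u) [Field k] (g : GenMap V W) {m n r : ℕ} (h : r + 1 = m + n)
    (i : Fin m) (x : Mon V m →₀ k) (y : Mon V n →₀ k) :
    Finsupp.lmapDomain k k g.onMon (freeCirc k V h i x y) =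
      freeCirc k W h i (Finsupp.lmapDomain k k g.onMon x) (Finsupp.lmapDomain k k g.onMon y) := by
  induction x using Finsupp.induction_linear with
  | zero => simp
  | add x x' hx hx' => simp only [map_add, LinearMap.add_apply, hx, hx']
  | single a c =>
  induction y using Finsupp.induction_linear with
  | zero => simp
  | add y y' hy hy' => simp only [map_add, hy, hy']
  | single b d =>
    simp only [Finsupp.lmapDomain_apply, Finsupp.mapDomain_single, freeCirc_single, onMon_circ]

theorem lmapDomain_act (k : Type u) [Field k] (g : GenMap V W) {n : ℕ} (σ : Equiv.Perm (Fin n))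
    (x : Mon V n →₀ k) :
    Finsupp.lmapDomain k k g.onMon (Finsupp.lmapDomain k k (Mon.act σ) x) =
      Finsupp.lmapDomain k k (Mon.act σ) (Finsupp.lmapDomain k k g.onMon x) := by
  simp only [Finsupp.lmapDomain_apply, ← Finsupp.mapDomain_comp]
  congr 1
  funext a
  exact g.onMon_act σ a

/-- The morphism of free operads determined by the images of the generators. -/
def freeHom (k : Type u) [Field k] (g : GenMap V W) : (free k V).Hom (free k W) where
  app _ := Finsupp.lmapDomain k k g.onMon
  app_act σ x := g.lmapDomain_act k σ x
  app_one := Finsupp.mapDomain_single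
  app_circ h i x y := g.lmapDomain_circ k h i x y

end GenMap

/-! ## The pre-induced operad of a unary-binary operad -/

/-- The symbols `≺_{ω,θ}` and `≻_{ω,θ}`. -/
inductive PreSymbol (W : Gens.{v}) : Type v
  | prec (ω : W.una) (θ : W.bin)
  | succ (ω : W.una) (θ : W.bin)

/-- The binary generators `≺_{ω,θ}`, `≻_{ω,θ}`, with `≺_{ω,θ}^{(12)} = ≻_{ω,θ'}` and
`≻_{ω,θ}^{(12)} = ≺_{ω,θ'}`. -/
def preGens (W : Gens.{v}) : Gens.{v} where
  una := PEmpty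
  bin := PreSymbol W
  swap
    | .prec ω θ => .succ ω (W.swap θ)
    | .succ ω θ => .prec ω (W.swap θ)
  swap_swap b := by cases b <;> simp [W.swap_swap]

/-- `≺_{ω,θ} ↦ θ(id ⊗ ω)` and `≻_{ω,θ} ↦ θ(ω ⊗ id)`. -/
def preMap (W : Gens.{v}) : GenMap (preGens W) W where
  una := nofun
  bin
    | .prec ω θ => .bin θ (.leaf 0) (.una ω (.leaf 1))
    | .succ ω θ => .bin θ (.una ω (.leaf 0)) (.leaf 1)
  una_linear := nofun
  bin_linear := by
    rintro (⟨ω, θ⟩ | ⟨ω, θ⟩) <;> exact .of [0, 1] rfl (by decide)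
  bin_swap := by
    rintro (⟨ω, θ⟩ | ⟨ω, θ⟩)
    · exact (Tree.Rel.swap θ (.leaf 1) (.una ω (.leaf 0))).symm
    · exact (Tree.Rel.swap θ (.una ω (.leaf 1)) (.leaf 0)).symm

/-- The morphism `F(≺_{ω,θ}, ≻_{ω,θ}) → F(W)/(R)` with `≺_{ω,θ} ↦ θ(id ⊗ ω)` and
`≻_{ω,θ} ↦ θ(ω ⊗ id)`. -/
def preHom (k : Type u) [Field k] (W : Gens.{v}) (R : Set (Σ n, (free k W).carrier n)) :
    (free k (preGens W)).Hom (presented k W R) :=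
  ((free k W).proj (.span (free k W) R)).comp ((preMap W).freeHom k)

/-- The relators of the pre-induced operad: the kernel of the above morphism in arity `3`. -/
def preRel (k : Type u) [Field k] (W : Gens.{v}) (R : Set (Σ n, (free k W).carrier n)) :
    Set (Σ n, (free k (preGens W)).carrier n) :=
  {x | ∃ r : (free k (preGens W)).carrier 3, (preHom k W R).app 3 r = 0 ∧ x = ⟨3, r⟩}

/-- The pre-induced binary quadratic operad of the unary-binary operad `F(W)/(R)`. -/
def preInduced (k : Type u) [Field k] (W : Gens.{v}) (R : Set (Σ n, (free k W).carrier n)) :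
    SymmOperad.{u, max u v} k :=
  presented k (preGens W) (preRel k W R)

/-! ## Commutative algebras with not necessarily commuting derivations -/

/-- The generators: a unary operation `∂_ω` for every `ω ∈ Ω`, and one commutative product `μ`. -/
def diffGens (Ω : Type v) : Gens.{v} where
  una := Ω
  bin := PUnit
  swap := id
  swap_swap _ := rfl

/-- The product of two trees. -/
def mul {Ω : Type v} {X : Type} (s t : Tree (diffGens Ω) X) : Tree (diffGens Ω) X :=
  .bin PUnit.unit s t

/-- A derivation applied to a tree. -/
def der {Ω : Type v} {X : Type} (ω : Ω) (s : Tree (diffGens Ω) X) : Tree (diffGens Ω) X :=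
  .una ω s

/-- `μ(μ ⊗ id) - μ(id ⊗ μ)` -/
def assocRel (k : Type u) [Field k] (Ω : Type v) : (free k (diffGens Ω)).carrier 3 :=
  tr k (mul (mul (.leaf 0) (.leaf 1)) (.leaf 2)) (.of [0, 1, 2] rfl (by decide)) -
    tr k (mul (.leaf 0) (mul (.leaf 1) (.leaf 2))) (.of [0, 1, 2] rfl (by decide))

/-- `μ - μ^{(12)}` -/
def commRel (k : Type u) [Field k] (Ω : Type v) : (free k (diffGens Ω)).carrier 2 :=
  tr k (mul (.leaf 0) (.leaf 1)) (.of [0, 1] rfl (by decide)) -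
    (free k (diffGens Ω)).act (Equiv.swap 0 1)
      (tr k (mul (.leaf 0) (.leaf 1)) (.of [0, 1] rfl (by decide)))

/-- `∂_ω μ - μ(id ⊗ ∂_ω) - μ(∂_ω ⊗ id)` -/
def leibnizRel (k : Type u) [Field k] {Ω : Type v} (ω : Ω) : (free k (diffGens Ω)).carrier 2 :=
  tr k (der ω (mul (.leaf 0) (.leaf 1))) (.of [0, 1] rfl (by decide)) -
    tr k (mul (.leaf 0) (der ω (.leaf 1))) (.of [0, 1] rfl (by decide)) -
    tr k (mul (der ω (.leaf 0)) (.leaf 1)) (.of [0, 1] rfl (by decide))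

/-- The relators of commutative algebras with derivations indexed by `Ω`, which need not commute. -/
def diffRel (k : Type u) [Field k] (Ω : Type v) : Set (Σ n, (free k (diffGens Ω)).carrier n) :=
  {⟨3, assocRel k Ω⟩, ⟨2, commRel k Ω⟩} ∪ Set.range (fun ω : Ω => ⟨2, leibnizRel k ω⟩)

/-- The operad of commutative algebras with not necessarily commuting derivations indexed
by `Ω`. -/
def NCDiffCom (k : Type u) [Field k] (Ω : Type v) : SymmOperad.{u, max u v} k :=
  presented k (diffGens Ω) (diffRel k Ω)

/-! ## Noncommuting multi-Novikov algebras -/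

/-- The products `▷_ω` and their opposites `▷'_ω`. -/
inductive NovSymbol (Ω : Type v) : Type v
  | op (ω : Ω)
  | opp (ω : Ω)

/-- The binary generators `▷_ω`, `▷'_ω`, exchanged by `(12)`. -/
def novGens (Ω : Type v) : Gens.{v} where
  una := PEmpty
  bin := NovSymbol Ω
  swap
    | .op ω => .opp ω
    | .opp ω => .op ω
  swap_swap b := by cases b <;> rfl

/-- The tree `s ▷_ω t`. -/
def nov {Ω : Type v} {X : Type} (ω : Ω) (s t : Tree (novGens Ω) X) : Tree (novGens Ω) X :=
  .bin (NovSymbol.op ω) s t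

/-- `(x ▷_ω y) ▷_τ z - x ▷_ω (y ▷_τ z) - (y ▷_ω x) ▷_τ z + y ▷_ω (x ▷_τ z)` -/
def leftSymmRel (k : Type u) [Field k] {Ω : Type v} (ω τ : Ω) : (free k (novGens Ω)).carrier 3 :=
  tr k (nov τ (nov ω (.leaf 0) (.leaf 1)) (.leaf 2)) (.of [0, 1, 2] rfl (by decide)) -
    tr k (nov ω (.leaf 0) (nov τ (.leaf 1) (.leaf 2))) (.of [0, 1, 2] rfl (by decide)) -
    tr k (nov τ (nov ω (.leaf 1) (.leaf 0)) (.leaf 2)) (.of [1, 0, 2] rfl (by decide)) +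
    tr k (nov ω (.leaf 1) (nov τ (.leaf 0) (.leaf 2))) (.of [1, 0, 2] rfl (by decide))

/-- `(x ▷_ω y) ▷_τ z - (x ▷_τ z) ▷_ω y` -/
def rightCommRel (k : Type u) [Field k] {Ω : Type v} (ω τ : Ω) : (free k (novGens Ω)).carrier 3 :=
  tr k (nov τ (nov ω (.leaf 0) (.leaf 1)) (.leaf 2)) (.of [0, 1, 2] rfl (by decide)) -
    tr k (nov ω (nov τ (.leaf 0) (.leaf 2)) (.leaf 1)) (.of [0, 2, 1] rfl (by decide))

/-- The `k[S₃]`-submodule generated by the relators of noncommuting multi-Novikov algebras. -/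
def novRel (k : Type u) [Field k] (Ω : Type v) : Submodule k ((free k (novGens Ω)).carrier 3) :=
  Submodule.span k
    {x | ∃ (σ : Equiv.Perm (Fin 3)) (ω τ : Ω),
      x = (free k (novGens Ω)).act σ (leftSymmRel k ω τ) ∨
      x = (free k (novGens Ω)).act σ (rightCommRel k ω τ)}

/-- The relators of noncommuting multi-Novikov algebras, as a set of operations. -/
def novRelSet (k : Type u) [Field k] (Ω : Type v) : Set (Σ n, (free k (novGens Ω)).carrier n) :=
  {x | ∃ r ∈ novRel k Ω, x = ⟨3, r⟩}

/-- The operad of noncommuting multi-Novikov algebras. -/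
def NCMultiNov (k : Type u) [Field k] (Ω : Type v) : SymmOperad.{u, max u v} k :=
  presented k (novGens Ω) (novRelSet k Ω)

/-- `▷_ω ↦ μ(id ⊗ ∂_ω)` and `▷'_ω ↦ μ'(∂_ω ⊗ id)`. -/
def novMap (Ω : Type v) : GenMap (novGens Ω) (diffGens Ω) where
  una := nofun
  bin
    | .op ω => .bin PUnit.unit (.leaf 0) (.una ω (.leaf 1))
    | .opp ω => .bin ((diffGens Ω).swap PUnit.unit) (.una ω (.leaf 0)) (.leaf 1)
  una_linear := nofun
  bin_linear := by
    rintro (ω | ω) <;> exact .of [0, 1] rfl (by decide)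
  bin_swap := by
    rintro (ω | ω)
    · exact (@Tree.Rel.swap (diffGens Ω) (Fin 2) PUnit.unit _ _ _ _ (.leaf 1) (.una ω (.leaf 0))).symm
    · exact (@Tree.Rel.swap (diffGens Ω) (Fin 2) PUnit.unit _ _ _ _ (.una ω (.leaf 1)) (.leaf 0)).symm

/-- The morphism `F(V) → NCDiffCom` with `▷_ω ↦ μ(id ⊗ ∂_ω)` and `▷'_ω ↦ μ'(∂_ω ⊗ id)`. -/
def novHom (k : Type u) [Field k] (Ω : Type v) :
    (free k (novGens Ω)).Hom (NCDiffCom k Ω) :=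
  ((free k (diffGens Ω)).proj (.span _ (diffRel k Ω))).comp ((novMap Ω).freeHom k)

/-- The corolla with one binary vertex and leaves `0, 1`, in a presented operad. -/
def gen₂ (k : Type u) [Field k] {W : Gens.{v}} (R : Set (Σ n, (free k W).carrier n))
    (θ : W.bin) : (presented k W R).carrier 2 :=
  trClass k R (.bin θ (.leaf 0) (.leaf 1)) (.of [0, 1] rfl (by decide))

end

end InducedStructure

/-! The generators of the two binary operads differ only by the renaming `▷_ω ↔ ≺_{ω,μ}`, `▷'_ω ↔
≻_{ω,μ}`, and this renaming is compatible with the two morphisms to the operad of differential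
algebras. The isomorphism is therefore a formal consequence of the equality `ker Φ ∩ F(V)(3) = R`
(`exists_iso_preInduced`), and all the content is in that equality (`ker_novHom`).

The inclusion of `R` in the kernel is a computation with `x ▷_ω y = x ∂_ω y`. The element `(x ▷_ω y)
▷_τ z = x ∂_ω y ∂_τ z` is unchanged when `(y, ω)` and `(z, τ)` are exchanged, and `x ▷_ω (y ▷_τ z) -
(x ▷_ω y) ▷_τ z = x y ∂_ω ∂_τ z` is symmetric in `x` and `y`.

For the converse no basis of the operad of differential algebras is needed, only one model that is
large enough. An operation in the kernel vanishes in every commutative algebra with derivations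
(`evalOp_freeHom_of_mem_ker`), in particular at the generators `x₀, x₁, x₂` of the algebra of
differential polynomials in noncommuting derivations. There an arity three Novikov monomial takes
the value `a ∂_ω b ∂_τ c` or `a ∂_ω b ∂_τ c + a b ∂_ω ∂_τ c`. Since monomials are a basis of the
polynomial ring, a linear map `polyClass` to `F(V)(3)/R` can be prescribed on them: `a ∂_ω b ∂_τ c`
goes to the class of `(a ▷_ω b) ▷_τ c`, and `a b ∂_ω ∂_τ c` to the class of `a ▷_ω (b ▷_τ c) - (a
▷_ω b) ▷_τ c`. The relations in `R` say exactly that these classes do not depend on the order of the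
interchangeable variables. Hence evaluation followed by `polyClass` is the quotient map
(`polyClass_evalOp`), and an operation with value zero lies in `R`. -/

namespace InducedStructure

universe u v w w'

/-! ### Operadic ideals and morphisms between quotient operads -/

namespace SymmOperad

variable {k : Type u} [Field k]

/-- The preimage of an operadic ideal under a morphism. -/
def OpIdeal.comap {P : SymmOperad.{u, w} k} {Q : SymmOperad.{u, w'} k} (f : Hom P Q)
    (J : OpIdeal Q) : OpIdeal P where
  sub n := (J.sub n).comap (f.app n)
  act_mem σ x hx := by
    simpa only [Submodule.mem_comap, f.app_act] using J.act_mem σ hx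
  circ_mem_left h i x y hx := by
    simpa only [Submodule.mem_comap, f.app_circ] using J.circ_mem_left h i _ hx
  circ_mem_right h i x y hy := by
    simpa only [Submodule.mem_comap, f.app_circ] using J.circ_mem_right h i _ hy

theorem OpIdeal.subset_span (P : SymmOperad.{u, w} k) {R : Set (Σ n, P.carrier n)} {n : ℕ}
    {x : P.carrier n} (hx : ⟨n, x⟩ ∈ R) : x ∈ (OpIdeal.span P R).sub n := by
  refine Submodule.mem_sInf.2 ?_
  rintro _ ⟨I, hI, rfl⟩
  exact hI _ hx

theorem OpIdeal.span_le {P : SymmOperad.{u, w} k} {R : Set (Σ n, P.carrier n)} (I : OpIdeal P)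
    (hI : ∀ x ∈ R, x.2 ∈ I.sub x.1) (n : ℕ) : (OpIdeal.span P R).sub n ≤ I.sub n :=
  sInf_le ⟨I, hI, rfl⟩

/-- The morphism of quotient operads induced by a morphism. -/
def Hom.quotMap {P : SymmOperad.{u, w} k} {Q : SymmOperad.{u, w'} k} (f : Hom P Q)
    (I : OpIdeal P) (J : OpIdeal Q) (h : ∀ n, I.sub n ≤ (J.sub n).comap (f.app n)) :
    Hom (P.quot I) (Q.quot J) where
  app n := (I.sub n).mapQ (J.sub n) (f.app n) (h n)
  app_act := by
    rintro n σ ⟨x⟩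
    exact congrArg (J.sub n).mkQ (f.app_act σ x)
  app_one := congrArg (J.sub 1).mkQ f.app_one
  app_circ := by
    rintro m n r h i ⟨x⟩ ⟨y⟩
    exact congrArg (J.sub r).mkQ (f.app_circ h i x y)

theorem Hom.quotMap_bijective {P : SymmOperad.{u, w} k} {Q : SymmOperad.{u, w'} k} (f : Hom P Q)
    (g : Hom Q P) (I : OpIdeal P) (J : OpIdeal Q)
    (hf : ∀ n, I.sub n ≤ (J.sub n).comap (f.app n))
    (hg : ∀ n, J.sub n ≤ (I.sub n).comap (g.app n))
    (hgf : ∀ n x, g.app n (f.app n x) = x) (hfg : ∀ n y, f.app n (g.app n y) = y) (n : ℕ) :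
    Function.Bijective ((f.quotMap I J hf).app n) := by
  refine Function.bijective_iff_has_inverse.2 ⟨(g.quotMap J I hg).app n, ?_, ?_⟩
  · rintro ⟨x⟩
    exact congrArg (I.sub n).mkQ (hgf n x)
  · rintro ⟨y⟩
    exact congrArg (J.sub n).mkQ (hfg n y)

end SymmOperad

open SymmOperad

/-! ### Composites of morphisms of free operads -/

namespace GenMap

variable {U V W : Gens.{v}}

theorem freeHom_freeHom (k : Type u) [Field k] (g : GenMap V W) (f : GenMap U V) (h : GenMap U W)
    (H : ∀ {n : ℕ} (s : Tree U (Fin n)), g.subst (f.subst s) = h.subst s) {n : ℕ}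
    (x : (free k U).carrier n) :
    (g.freeHom k).app n ((f.freeHom k).app n x) = (h.freeHom k).app n x := by
  refine Finsupp.mapDomain_comp.symm.trans (congrArg (fun φ => Finsupp.mapDomain φ _) ?_)
  funext a
  induction a using Mon.ind with
  | h s hs => exact Mon.mk_congr _ _ (H s)

theorem freeHom_freeHom_id (k : Type u) [Field k] (g : GenMap V U) (f : GenMap U V)
    (H : ∀ {n : ℕ} (s : Tree U (Fin n)), g.subst (f.subst s) = s) {n : ℕ}
    (x : (free k U).carrier n) :
    (g.freeHom k).app n ((f.freeHom k).app n x) = x := by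
  refine Finsupp.mapDomain_comp.symm.trans
    (Eq.trans (congrArg (fun φ => Finsupp.mapDomain φ _) ?_) Finsupp.mapDomain_id)
  funext a
  induction a using Mon.ind with
  | h s hs => exact Mon.mk_congr _ _ (H s)

theorem freeHom_tr (k : Type u) [Field k] (g : GenMap V W) {n : ℕ} (s : Tree V (Fin n))
    (hs : s.Linear) :
    (g.freeHom k).app n (tr k s hs) = tr k (g.subst s) (g.subst_linear hs) :=
  Finsupp.mapDomain_single

end GenMap

/-! ### Renaming the generators and the reduction to the kernel in arity three -/

section Renaming

variable (Ω : Type v)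

/-- The renaming `▷_ω ↦ ≺_{ω,μ}`, `▷'_ω ↦ ≻_{ω,μ}`. -/
def novToPre : GenMap (novGens Ω) (preGens (diffGens Ω)) where
  una := nofun
  bin
    | .op ω => .bin (PreSymbol.prec ω PUnit.unit) (.leaf 0) (.leaf 1)
    | .opp ω => .bin (PreSymbol.succ ω PUnit.unit) (.leaf 0) (.leaf 1)
  una_linear := nofun
  bin_linear := by
    rintro (ω | ω) <;> exact .of [0, 1] rfl (by decide)
  bin_swap := by
    rintro (ω | ω)
    · exact (@Tree.Rel.swap (preGens (diffGens Ω)) (Fin 2) (.prec ω PUnit.unit) _ _ _ _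
        (.leaf 1) (.leaf 0)).symm
    · exact (@Tree.Rel.swap (preGens (diffGens Ω)) (Fin 2) (.succ ω PUnit.unit) _ _ _ _
        (.leaf 1) (.leaf 0)).symm

/-- The renaming `≺_{ω,μ} ↦ ▷_ω`, `≻_{ω,μ} ↦ ▷'_ω`. -/
def preToNov : GenMap (preGens (diffGens Ω)) (novGens Ω) where
  una := nofun
  bin
    | .prec ω _ => .bin (NovSymbol.op ω) (.leaf 0) (.leaf 1)
    | .succ ω _ => .bin (NovSymbol.opp ω) (.leaf 0) (.leaf 1)
  una_linear := nofun
  bin_linear := by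
    rintro (⟨ω, _⟩ | ⟨ω, _⟩) <;> exact .of [0, 1] rfl (by decide)
  bin_swap := by
    rintro (⟨ω, _⟩ | ⟨ω, _⟩)
    · exact (@Tree.Rel.swap (novGens Ω) (Fin 2) (.op ω) _ _ _ _ (.leaf 1) (.leaf 0)).symm
    · exact (@Tree.Rel.swap (novGens Ω) (Fin 2) (.opp ω) _ _ _ _ (.leaf 1) (.leaf 0)).symm

variable {Ω} {X : Type}

theorem preToNov_novToPre (s : Tree (novGens Ω) X) :
    (preToNov Ω).subst ((novToPre Ω).subst s) = s := by
  induction s with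
  | leaf x => rfl
  | una ω _ _ => exact ω.elim
  | bin θ s t ihs iht =>
    rcases θ with ω | ω <;> exact congrArg₂ (Tree.bin _) ihs iht

theorem novToPre_preToNov (s : Tree (preGens (diffGens Ω)) X) :
    (novToPre Ω).subst ((preToNov Ω).subst s) = s := by
  induction s with
  | leaf x => rfl
  | una ω _ _ => exact ω.elim
  | bin θ s t ihs iht =>
    rcases θ with ⟨ω, _⟩ | ⟨ω, _⟩ <;> exact congrArg₂ (Tree.bin _) ihs iht

theorem preMap_novToPre (s : Tree (novGens Ω) X) :
    (preMap (diffGens Ω)).subst ((novToPre Ω).subst s) = (novMap Ω).subst s := by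
  induction s with
  | leaf x => rfl
  | una ω _ _ => exact ω.elim
  | bin θ s t ihs iht =>
    rcases θ with ω | ω
    · exact congrArg₂ (fun s t => Tree.bin _ s (Tree.una ω t)) ihs iht
    · exact congrArg₂ (fun s t => Tree.bin _ (Tree.una ω s) t) ihs iht

/-- Up to renaming, the two morphisms to the operad of differential algebras have the same kernel,
so relators can be transported in both directions. -/
theorem preHom_novToPre (k : Type u) [Field k] {n : ℕ} (x : (free k (novGens Ω)).carrier n) :
    (preHom k (diffGens Ω) (diffRel k Ω)).app n (((novToPre Ω).freeHom k).app n x) =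
      (novHom k Ω).app n x :=
  congrArg (Submodule.mkQ _) (GenMap.freeHom_freeHom k _ _ _ preMap_novToPre x)

end Renaming

/-- If the relators of noncommuting multi-Novikov algebras are the kernel of `novHom` in arity `3`,
then renaming the generators is an isomorphism onto the pre-induced operad. -/
theorem exists_iso_preInduced (k : Type u) [Field k] (Ω : Type v)
    (hker : LinearMap.ker ((novHom k Ω).app 3) = novRel k Ω) :
    ∃ e : (NCMultiNov k Ω).Hom (preInduced k (diffGens Ω) (diffRel k Ω)),
      (∀ n, Function.Bijective (e.app n)) ∧
      ∀ ω : Ω,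
        e.app 2 (gen₂ k (novRelSet k Ω) (NovSymbol.op ω)) =
          gen₂ k (preRel k (diffGens Ω) (diffRel k Ω)) (PreSymbol.prec ω PUnit.unit) ∧
        e.app 2 (gen₂ k (novRelSet k Ω) (NovSymbol.opp ω)) =
          gen₂ k (preRel k (diffGens Ω) (diffRel k Ω)) (PreSymbol.succ ω PUnit.unit) := by
  have hf : ∀ n, (OpIdeal.span _ (novRelSet k Ω)).sub n ≤
      ((OpIdeal.span _ (preRel k (diffGens Ω) (diffRel k Ω))).sub n).comap
        (((novToPre Ω).freeHom k).app n) := by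
    refine (OpIdeal.span_le (OpIdeal.comap ((novToPre Ω).freeHom k) (OpIdeal.span _ _)) ?_)
    rintro _ ⟨r, hr, rfl⟩
    rw [← hker] at hr
    exact OpIdeal.subset_span _ ⟨_, (preHom_novToPre k r).trans hr, rfl⟩
  have hfg : ∀ n y, ((novToPre Ω).freeHom k).app n (((preToNov Ω).freeHom k).app n y) = y :=
    fun n y => GenMap.freeHom_freeHom_id k _ _ novToPre_preToNov y
  have hg : ∀ n, (OpIdeal.span _ (preRel k (diffGens Ω) (diffRel k Ω))).sub n ≤
      ((OpIdeal.span _ (novRelSet k Ω)).sub n).comap (((preToNov Ω).freeHom k).app n) := by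
    refine (OpIdeal.span_le (OpIdeal.comap ((preToNov Ω).freeHom k) (OpIdeal.span _ _)) ?_)
    rintro _ ⟨r, hr, rfl⟩
    refine OpIdeal.subset_span _ ⟨_, ?_, rfl⟩
    -- Membership in `R` is tested by applying `novHom`. On a relator pulled back by `preToNov` this
    -- gives `preHom` of the relator itself, because the two renamings cancel.
    rw [← hker, LinearMap.mem_ker, ← preHom_novToPre, hfg]
    exact hr
  refine ⟨((novToPre Ω).freeHom k).quotMap _ _ hf,
    Hom.quotMap_bijective _ ((preToNov Ω).freeHom k) _ _ hf hg
      (fun n x => GenMap.freeHom_freeHom_id k _ _ preToNov_novToPre x) hfg, fun ω => ⟨?_, ?_⟩⟩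
  · exact congrArg (Submodule.mkQ _) ((novToPre Ω).freeHom_tr k _ _)
  · exact congrArg (Submodule.mkQ _) ((novToPre Ω).freeHom_tr k _ _)

/-! ### Computing with tree monomials -/

section Trees

variable (k : Type u) [Field k] {W : Gens.{v}}

theorem tr_congr {n : ℕ} {s t : Tree W (Fin n)} (hs : s.Linear) (ht : t.Linear)
    (h : Tree.Rel s t) : tr k s hs = tr k t ht :=
  congrArg (fun a => Finsupp.single a (1 : k)) (Mon.mk_eq hs ht h)

/-- The result `u` is an argument of its own, so that for concrete trees the expected shape can be
written down and the grafting checked by `rfl`. -/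
theorem circ_tr {m n r : ℕ} (h : r + 1 = m + n) (i : Fin m) {s : Tree W (Fin m)}
    {t : Tree W (Fin n)} (hs : s.Linear) (ht : t.Linear) {u : Tree W (Fin r)} (hu : u.Linear)
    (e : Tree.graft h i s t = u) :
    (free k W).circ h i (tr k s hs) (tr k t ht) = tr k u hu := by
  subst e
  refine (freeCirc_single k W h i _ _ 1 1).trans ?_
  rw [one_mul]
  rfl

theorem act_tr {n : ℕ} (σ : Equiv.Perm (Fin n)) {s : Tree W (Fin n)} (hs : s.Linear)
    {u : Tree W (Fin n)} (hu : u.Linear) (e : s.map ⇑σ⁻¹ = u) :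
    (free k W).act σ (tr k s hs) = tr k u hu := by
  subst e
  exact Finsupp.mapDomain_single

end Trees

/-- The generator `μ` is its own transpose, so commutativity already holds among tree monomials,
before any relator is imposed. -/
theorem mul_comm_rel {Ω : Type v} {X : Type} (s t : Tree (diffGens Ω) X) :
    Tree.Rel (mul s t) (mul t s) :=
  .swap (W := diffGens Ω) PUnit.unit (.refl s) (.refl t)

/-! ### The Novikov relations hold for `x ∂_ω y` -/

section RelationsHold

variable (k : Type u) [Field k] {Ω : Type v}

/-- The ideal of relations of commutative algebras with derivations. -/
noncomputable abbrev diffIdeal (k : Type u) [Field k] (Ω : Type v) : OpIdeal (free k (diffGens Ω)) :=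
  .span _ (diffRel k Ω)

theorem assocRel_mem : assocRel k Ω ∈ (diffIdeal k Ω).sub 3 :=
  OpIdeal.subset_span _ (.inl (.inl rfl))

theorem leibnizRel_mem (ω : Ω) : leibnizRel k ω ∈ (diffIdeal k Ω).sub 2 :=
  OpIdeal.subset_span _ (.inr ⟨ω, rfl⟩)

/-- `(x ∂_ω y) ∂_τ z - x (∂_ω y ∂_τ z)` -/
theorem assoc_der_der_mem (ω τ : Ω) :
    tr k (mul (mul (.leaf 0) (der ω (.leaf 1))) (der τ (.leaf 2)))
        (.of [0, 1, 2] rfl (by decide)) -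
      tr k (mul (.leaf 0) (mul (der ω (.leaf 1)) (der τ (.leaf 2))))
        (.of [0, 1, 2] rfl (by decide)) ∈ (diffIdeal k Ω).sub 3 := by
  -- The associativity relator with `∂_ω` grafted at input `1` and `∂_τ` at input `2`; grafting
  -- unary operations leaves the numbering unchanged.
  have h := (diffIdeal k Ω).circ_mem_left (r := 3) rfl 2
    (tr k (der τ (.leaf 0)) (.of [0] rfl (by decide)))
    ((diffIdeal k Ω).circ_mem_left (r := 3) rfl 1
      (tr k (der ω (.leaf 0)) (.of [0] rfl (by decide))) (assocRel_mem k))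
  simp only [assocRel, map_sub, LinearMap.sub_apply] at h
  rwa [circ_tr k rfl 1 _ _ (u := mul (mul (.leaf 0) (der ω (.leaf 1))) (.leaf 2))
      (.of [0, 1, 2] rfl (by decide)) rfl,
    circ_tr k rfl 1 _ _ (u := mul (.leaf 0) (mul (der ω (.leaf 1)) (.leaf 2)))
      (.of [0, 1, 2] rfl (by decide)) rfl,
    circ_tr k rfl 2 _ _ (u := mul (mul (.leaf 0) (der ω (.leaf 1))) (der τ (.leaf 2)))
      (.of [0, 1, 2] rfl (by decide)) rfl,
    circ_tr k rfl 2 _ _ (u := mul (.leaf 0) (mul (der ω (.leaf 1)) (der τ (.leaf 2))))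
      (.of [0, 1, 2] rfl (by decide)) rfl] at h

/-- `(x y) ∂_ω ∂_τ z - x (y ∂_ω ∂_τ z)` -/
theorem assoc_der₂_mem (ω τ : Ω) :
    tr k (mul (mul (.leaf 0) (.leaf 1)) (der ω (der τ (.leaf 2))))
        (.of [0, 1, 2] rfl (by decide)) -
      tr k (mul (.leaf 0) (mul (.leaf 1) (der ω (der τ (.leaf 2)))))
        (.of [0, 1, 2] rfl (by decide)) ∈ (diffIdeal k Ω).sub 3 := by
  have h := (diffIdeal k Ω).circ_mem_left (r := 3) rfl 2
    (tr k (der ω (der τ (.leaf 0))) (.of [0] rfl (by decide))) (assocRel_mem k)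
  simp only [assocRel, map_sub, LinearMap.sub_apply] at h
  rwa [circ_tr k rfl 2 _ _ (u := mul (mul (.leaf 0) (.leaf 1)) (der ω (der τ (.leaf 2))))
      (.of [0, 1, 2] rfl (by decide)) rfl,
    circ_tr k rfl 2 _ _ (u := mul (.leaf 0) (mul (.leaf 1) (der ω (der τ (.leaf 2)))))
      (.of [0, 1, 2] rfl (by decide)) rfl] at h

/-- `x ∂_ω (y ∂_τ z) - x (y ∂_ω ∂_τ z) - x (∂_ω y ∂_τ z)` -/
theorem leibniz_der_mem (ω τ : Ω) :
    tr k (mul (.leaf 0) (der ω (mul (.leaf 1) (der τ (.leaf 2)))))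
        (.of [0, 1, 2] rfl (by decide)) -
      tr k (mul (.leaf 0) (mul (.leaf 1) (der ω (der τ (.leaf 2)))))
        (.of [0, 1, 2] rfl (by decide)) -
      tr k (mul (.leaf 0) (mul (der ω (.leaf 1)) (der τ (.leaf 2))))
        (.of [0, 1, 2] rfl (by decide)) ∈ (diffIdeal k Ω).sub 3 := by
  -- The Leibniz relator with `∂_τ` grafted at its second input, the whole then grafted at the
  -- second input of `μ`.
  have h := (diffIdeal k Ω).circ_mem_right (m := 2) (n := 2) (r := 3) rfl 1
    (tr k (mul (.leaf 0) (.leaf 1)) (.of [0, 1] rfl (by decide)))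
    ((diffIdeal k Ω).circ_mem_left (r := 2) rfl 1
      (tr k (der τ (.leaf 0)) (.of [0] rfl (by decide))) (leibnizRel_mem k ω))
  simp only [leibnizRel, map_sub, LinearMap.sub_apply] at h
  rwa [circ_tr k rfl 1 _ _ (u := der ω (mul (.leaf 0) (der τ (.leaf 1))))
      (.of [0, 1] rfl (by decide)) rfl,
    circ_tr k rfl 1 _ _ (u := mul (.leaf 0) (der ω (der τ (.leaf 1))))
      (.of [0, 1] rfl (by decide)) rfl,
    circ_tr k rfl 1 _ _ (u := mul (der ω (.leaf 0)) (der τ (.leaf 1)))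
      (.of [0, 1] rfl (by decide)) rfl,
    circ_tr k (m := 2) (n := 2) rfl 1 _ _ (u := mul (.leaf 0) (der ω (mul (.leaf 1) (der τ (.leaf 2)))))
      (.of [0, 1, 2] rfl (by decide)) rfl,
    circ_tr k (m := 2) (n := 2) rfl 1 _ _ (u := mul (.leaf 0) (mul (.leaf 1) (der ω (der τ (.leaf 2)))))
      (.of [0, 1, 2] rfl (by decide)) rfl,
    circ_tr k (m := 2) (n := 2) rfl 1 _ _ (u := mul (.leaf 0) (mul (der ω (.leaf 1)) (der τ (.leaf 2))))
      (.of [0, 1, 2] rfl (by decide)) rfl] at h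

/-- The associator `(x ▷_ω y) ▷_τ z - x ▷_ω (y ▷_τ z)` becomes `-(x y) ∂_ω ∂_τ z`, which is
symmetric in `x` and `y`. -/
theorem novMap_leftSymmRel_mem (ω τ : Ω) :
    ((novMap Ω).freeHom k).app 3 (leftSymmRel k ω τ) ∈ (diffIdeal k Ω).sub 3 := by
  have key : tr k (mul (mul (.leaf 0) (der ω (.leaf 1))) (der τ (.leaf 2)))
        (.of [0, 1, 2] rfl (by decide)) -
      tr k (mul (.leaf 0) (der ω (mul (.leaf 1) (der τ (.leaf 2)))))
        (.of [0, 1, 2] rfl (by decide)) +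
      tr k (mul (mul (.leaf 0) (.leaf 1)) (der ω (der τ (.leaf 2))))
        (.of [0, 1, 2] rfl (by decide)) ∈ (diffIdeal k Ω).sub 3 := by
    convert add_mem (sub_mem (assoc_der_der_mem k ω τ) (leibniz_der_mem k ω τ))
      (assoc_der₂_mem k ω τ) using 1
    abel
  have cancel : ∀ a b c d e : (free k (diffGens Ω)).carrier 3,
      a - b + e - (c - d + e) = a - b - c + d := fun a b c d e => by abel
  -- Antisymmetrizing `key` in the first two inputs cancels the terms `(x y) ∂_ω ∂_τ z` and `(y x)
  -- ∂_ω ∂_τ z`, which are the same tree monomial; the left-symmetry relator remains.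
  have h := sub_mem key ((diffIdeal k Ω).act_mem (Equiv.swap 0 1) key)
  simp only [map_sub, map_add] at h
  rw [act_tr k _ _ (u := mul (mul (.leaf 1) (der ω (.leaf 0))) (der τ (.leaf 2)))
      (.of [1, 0, 2] rfl (by decide)) rfl,
    act_tr k _ _ (u := mul (.leaf 1) (der ω (mul (.leaf 0) (der τ (.leaf 2)))))
      (.of [1, 0, 2] rfl (by decide)) rfl,
    act_tr k _ _ (u := mul (mul (.leaf 1) (.leaf 0)) (der ω (der τ (.leaf 2))))
      (.of [1, 0, 2] rfl (by decide)) rfl,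
    tr_congr k (s := mul (mul (.leaf 1) (.leaf 0)) (der ω (der τ (.leaf 2))))
      (t := mul (mul (.leaf 0) (.leaf 1)) (der ω (der τ (.leaf 2)))) _
      (.of [0, 1, 2] rfl (by decide)) (.bin _ (mul_comm_rel _ _) (.refl _)), cancel] at h
  rw [leftSymmRel, map_add, map_sub, map_sub]
  simp only [GenMap.freeHom_tr]
  exact h

/-- Both terms reassociate to `x (∂_ω y ∂_τ z)`, by commutativity of the inner product. -/
theorem novMap_rightCommRel_mem (ω τ : Ω) :
    ((novMap Ω).freeHom k).app 3 (rightCommRel k ω τ) ∈ (diffIdeal k Ω).sub 3 := by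
  have h := sub_mem (assoc_der_der_mem k ω τ)
    ((diffIdeal k Ω).act_mem (Equiv.swap 1 2) (assoc_der_der_mem k τ ω))
  simp only [map_sub] at h
  rw [act_tr k _ _ (u := mul (mul (.leaf 0) (der τ (.leaf 2))) (der ω (.leaf 1)))
      (.of [0, 2, 1] rfl (by decide)) rfl,
    act_tr k _ _ (u := mul (.leaf 0) (mul (der τ (.leaf 2)) (der ω (.leaf 1))))
      (.of [0, 2, 1] rfl (by decide)) rfl,
    tr_congr k (s := mul (.leaf 0) (mul (der τ (.leaf 2)) (der ω (.leaf 1))))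
      (t := mul (.leaf 0) (mul (der ω (.leaf 1)) (der τ (.leaf 2)))) _
      (.of [0, 1, 2] rfl (by decide)) (.bin _ (.refl _) (mul_comm_rel _ _)),
    sub_sub_sub_cancel_right] at h
  rw [rightCommRel, map_sub]
  simp only [GenMap.freeHom_tr]
  exact h

theorem novRel_le_ker : novRel k Ω ≤ LinearMap.ker ((novHom k Ω).app 3) := by
  refine Submodule.span_le.2 ?_
  rintro _ ⟨σ, ω, τ, rfl | rfl⟩ <;> refine LinearMap.mem_ker.2 ?_ <;> rw [Hom.app_act] <;>
    refine (congrArg _ ((Submodule.Quotient.mk_eq_zero _).2 ?_)).trans (map_zero _)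
  exacts [novMap_leftSymmRel_mem k ω τ, novMap_rightCommRel_mem k ω τ]

end RelationsHold

/-! ### Evaluation in commutative algebras with derivations -/

section Evaluation

variable {k : Type u} [Field k] {Ω : Type v} {A : Type*} [CommRing A] [Algebra k A]
  (D : Ω → Derivation k A A)

/-- The value of a tree in a commutative algebra with derivations. -/
def evalTree {X : Type} (f : X → A) : Tree (diffGens Ω) X → A
  | .leaf x => f x
  | .una ω s => D ω (evalTree f s)
  | .bin _ s t => evalTree f s * evalTree f t

theorem evalTree_bind {X Y : Type} (f : Y → A) (s : Tree (diffGens Ω) X)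
    (g : X → Tree (diffGens Ω) Y) :
    evalTree D f (s.bind g) = evalTree D (fun x => evalTree D f (g x)) s := by
  induction s with
  | leaf x => rfl
  | una ω s ih => exact congrArg (D ω) ih
  | bin θ s t ihs iht => exact congrArg₂ (· * ·) ihs iht

theorem evalTree_rel {X : Type} (f : X → A) {s t : Tree (diffGens Ω) X} (h : Tree.Rel s t) :
    evalTree D f s = evalTree D f t := by
  induction h with
  | leaf x => rfl
  | una ω _ ih => exact congrArg (D ω) ih
  | bin θ _ _ ihs iht => exact congrArg₂ (· * ·) ihs iht
  | swap θ _ _ ihs iht => exact (congrArg₂ (· * ·) ihs iht).trans (mul_comm _ _)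

theorem evalTree_congr {X : Type} {f g : X → A} (s : Tree (diffGens Ω) X)
    (h : ∀ x ∈ s.leaves, f x = g x) : evalTree D f s = evalTree D g s := by
  induction s with
  | leaf x => exact h x (List.mem_singleton_self x)
  | una ω s ih => exact congrArg (D ω) (ih h)
  | bin θ s t ihs iht =>
    exact congrArg₂ (· * ·) (ihs fun x hx => h x (List.mem_append_left _ hx))
      (iht fun x hx => h x (List.mem_append_right _ hx))

/-- The value of a tree depends linearly on the value of a variable that occurs exactly once. -/
theorem exists_evalTree_update {X : Type} [DecidableEq X] (f : X → A) (i : X)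
    (s : Tree (diffGens Ω) X) (hs : s.leaves.count i = 1) :
    ∃ l : A →ₗ[k] A, ∀ u, evalTree D (Function.update f i u) s = l u := by
  have const : ∀ t : Tree (diffGens Ω) X, t.leaves.count i = 0 → ∀ u,
      evalTree D (Function.update f i u) t = evalTree D f t := fun t ht u =>
    evalTree_congr D t fun x hx =>
      Function.update_of_ne (fun e => List.count_eq_zero.1 ht (by rwa [← e])) _ _
  induction s with
  | leaf x =>
    obtain rfl : x = i := by
      by_contra hx
      simp [Tree.leaves, hx] at hs
    exact ⟨LinearMap.id, fun u => Function.update_self _ _ _⟩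
  | una ω s ih =>
    obtain ⟨l, hl⟩ := ih hs
    exact ⟨(D ω).toLinearMap.comp l, fun u => congrArg (D ω) (hl u)⟩
  | bin θ s t ihs iht =>
    rw [Tree.leaves, List.count_append] at hs
    -- The variable occurs in exactly one factor; the other factor is constant, and multiplication
    -- by it is linear.
    rcases Nat.add_eq_one_iff.1 hs with ⟨h₀, h₁⟩ | ⟨h₁, h₀⟩
    · obtain ⟨l, hl⟩ := iht h₁
      refine ⟨(LinearMap.mulLeft k (evalTree D f s)).comp l, fun u => ?_⟩
      exact congrArg₂ (· * ·) (const s h₀ u) (hl u)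
    · obtain ⟨l, hl⟩ := ihs h₁
      refine ⟨(LinearMap.mulRight k (evalTree D f t)).comp l, fun u => ?_⟩
      exact congrArg₂ (· * ·) (hl u) (const t h₀ u)

/-- The value of a tree monomial. -/
def evalMon {n : ℕ} (f : Fin n → A) : Mon (diffGens Ω) n → A :=
  Quotient.lift (fun s => evalTree D f s.1) (fun _ _ h => evalTree_rel D f h)

/-- The value of an operation of the free operad. -/
noncomputable def evalFree {n : ℕ} (f : Fin n → A) : (Mon (diffGens Ω) n →₀ k) →ₗ[k] A :=
  Finsupp.linearCombination k (evalMon D f)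

theorem evalFree_act {n : ℕ} (f : Fin n → A) (σ : Equiv.Perm (Fin n))
    (x : Mon (diffGens Ω) n →₀ k) :
    evalFree D f (Finsupp.lmapDomain k k (Mon.act σ) x) = evalFree D (fun i => f (σ⁻¹ i)) x := by
  refine (Finsupp.linearCombination_mapDomain k _ _).trans ?_
  refine congrArg (fun φ => Finsupp.linearCombination k φ x) ?_
  funext a
  induction a using Mon.ind with
  | h s hs => exact evalTree_bind D f s _

/-- The values of the inputs of `x` in `x ∘ᵢ y`, where the value of `y` is `c`. -/
def graftVal {m n r : ℕ} (h : r + 1 = m + n) (i : Fin m) (f : Fin r → A) (c : A) : Fin m → A :=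
  fun x => if hx : x = i then c else f (outPos h i x hx)

theorem evalMon_circ {m n r : ℕ} (h : r + 1 = m + n) (i : Fin m) (f : Fin r → A)
    (a : Mon (diffGens Ω) m) (b : Mon (diffGens Ω) n) :
    evalMon D f (Mon.circ h i a b) =
      evalMon D (graftVal h i f (evalMon D (fun y => f (inPos h i y)) b)) a := by
  induction a using Mon.ind with
  | h s hs =>
  induction b using Mon.ind with
  | h t ht =>
    refine (evalTree_bind D f s _).trans (congrArg (fun g => evalTree D g s) ?_)
    funext x
    by_cases hx : x = i
    · simp only [hx, dite_true, graftVal]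
      exact evalTree_bind D f t _
    · simp only [hx, dite_false, graftVal]
      rfl

theorem evalFree_circ_single {m n r : ℕ} (h : r + 1 = m + n) (i : Fin m) (f : Fin r → A)
    (x : Mon (diffGens Ω) m →₀ k) (b : Mon (diffGens Ω) n) (d : k) :
    evalFree D f (freeCirc k _ h i x (Finsupp.single b d)) =
      d • evalFree D (graftVal h i f (evalMon D (fun y => f (inPos h i y)) b)) x := by
  induction x using Finsupp.induction_linear with
  | zero => simp
  | add x x' hx hx' => simp only [map_add, LinearMap.add_apply, hx, hx', smul_add]
  | single a c =>
    simp only [freeCirc_single, evalFree, Finsupp.linearCombination_single, evalMon_circ,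
      smul_smul, mul_comm]

/-- Input `i` occurs exactly once in the monomial `a`, so the value of `a ∘ᵢ y` is a linear function
of the value of `y`, also when `y` is a combination of several monomials. -/
theorem exists_evalFree_single_circ {m n r : ℕ} (h : r + 1 = m + n) (i : Fin m) (f : Fin r → A)
    (a : Mon (diffGens Ω) m) (c : k) : ∃ l : A →ₗ[k] A, ∀ y : Mon (diffGens Ω) n →₀ k,
      evalFree D f (freeCirc k _ h i (Finsupp.single a c) y) =
        l (evalFree D (fun y => f (inPos h i y)) y) := by
  obtain ⟨l, hl⟩ : ∃ l : A →ₗ[k] A, ∀ u, evalMon D (graftVal h i f u) a = l u := by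
    induction a using Mon.ind with
    | h s hs =>
      have hs' : s.leaves.count i = 1 := by
        rw [hs.count_eq]
        exact List.count_eq_one_of_mem (List.nodup_finRange m) (List.mem_finRange i)
      obtain ⟨l, hl⟩ := exists_evalTree_update D (graftVal h i f 0) i s hs'
      refine ⟨l, fun u => Eq.trans (congrArg (fun g => evalTree D g s) ?_) (hl u)⟩
      funext x
      by_cases hx : x = i
      · subst hx
        simp [graftVal]
      · simp [graftVal, hx]
  refine ⟨c • l, fun y => ?_⟩
  induction y using Finsupp.induction_linear with
  | zero => simp
  | add y y' hy hy' => simp only [map_add, hy, hy']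
  | single b d =>
    simp only [freeCirc_single, evalFree, Finsupp.linearCombination_single, evalMon_circ, hl,
      map_smul, LinearMap.smul_apply, smul_smul, mul_comm]

theorem evalFree_circ_eq_zero_left {m n r : ℕ} (h : r + 1 = m + n) (i : Fin m) (f : Fin r → A)
    (x : Mon (diffGens Ω) m →₀ k) (y : Mon (diffGens Ω) n →₀ k) (hx : ∀ g, evalFree D g x = 0) :
    evalFree D f (freeCirc k _ h i x y) = 0 := by
  induction y using Finsupp.induction_linear with
  | zero => simp
  | add y y' hy hy' => rw [map_add, map_add, hy, hy', add_zero]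
  | single b d => rw [evalFree_circ_single, hx, smul_zero]

theorem evalFree_circ_eq_zero_right {m n r : ℕ} (h : r + 1 = m + n) (i : Fin m) (f : Fin r → A)
    (x : Mon (diffGens Ω) m →₀ k) (y : Mon (diffGens Ω) n →₀ k) (hy : ∀ g, evalFree D g y = 0) :
    evalFree D f (freeCirc k _ h i x y) = 0 := by
  induction x using Finsupp.induction_linear with
  | zero => simp
  | add x x' hx hx' => rw [map_add, LinearMap.add_apply, map_add, hx, hx', add_zero]
  | single a c =>
    obtain ⟨l, hl⟩ := exists_evalFree_single_circ D h i f a c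
    rw [hl, hy, map_zero]

/-- `evalFree`, as a linear map on the components of the free operad. -/
noncomputable def evalOp {n : ℕ} (f : Fin n → A) : (free k (diffGens Ω)).carrier n →ₗ[k] A :=
  evalFree D f

theorem evalOp_tr {n : ℕ} (f : Fin n → A) {s : Tree (diffGens Ω) (Fin n)} (hs : s.Linear) :
    evalOp D f (tr k s hs) = evalTree D f s :=
  (Finsupp.linearCombination_single k _ _).trans (one_smul k _)

theorem evalOp_act {n : ℕ} (f : Fin n → A) (σ : Equiv.Perm (Fin n))
    (x : (free k (diffGens Ω)).carrier n) :
    evalOp D f ((free k (diffGens Ω)).act σ x) = evalOp D (fun i => f (σ⁻¹ i)) x :=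
  evalFree_act D f σ x

/-- The ideal of operations that vanish in a commutative algebra with derivations. -/
noncomputable def vanishingIdeal : OpIdeal (free k (diffGens Ω)) where
  sub n := ⨅ f : Fin n → A, LinearMap.ker (evalOp (k := k) D f)
  act_mem σ x hx := by
    rw [Submodule.mem_iInf] at hx ⊢
    exact fun f => (evalOp_act D f σ x).trans (hx _)
  circ_mem_left h i x y hx := by
    rw [Submodule.mem_iInf] at hx ⊢
    exact fun f => evalFree_circ_eq_zero_left D h i f x y hx
  circ_mem_right h i x y hy := by
    rw [Submodule.mem_iInf] at hy ⊢
    exact fun f => evalFree_circ_eq_zero_right D h i f x y hy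

theorem evalOp_assocRel (f : Fin 3 → A) : evalOp D f (assocRel k Ω) = 0 := by
  rw [assocRel, map_sub, evalOp_tr, evalOp_tr]
  exact sub_eq_zero.2 (mul_assoc _ _ _)

theorem evalOp_commRel (f : Fin 2 → A) : evalOp D f (commRel k Ω) = 0 := by
  rw [commRel, map_sub, evalOp_act, evalOp_tr, evalOp_tr]
  exact sub_eq_zero.2 (mul_comm (f 0) (f 1))

theorem evalOp_leibnizRel (f : Fin 2 → A) (ω : Ω) : evalOp D f (leibnizRel k ω) = 0 := by
  rw [leibnizRel, map_sub, map_sub, evalOp_tr, evalOp_tr, evalOp_tr]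
  change D ω (f 0 * f 1) - f 0 * D ω (f 1) - D ω (f 0) * f 1 = 0
  rw [Derivation.leibniz]
  simp only [smul_eq_mul]
  ring

/-- Identically vanishing operations form an operadic ideal, so only the defining relators have to
be evaluated. -/
theorem diffIdeal_le_vanishingIdeal (n : ℕ) :
    (diffIdeal k Ω).sub n ≤ (vanishingIdeal (k := k) D).sub n := by
  refine OpIdeal.span_le (vanishingIdeal D) ?_ n
  rintro _ ((rfl | rfl) | ⟨ω, rfl⟩) <;> refine (Submodule.mem_iInf _).2 fun f => ?_
  exacts [evalOp_assocRel D f, evalOp_commRel D f, evalOp_leibnizRel D f ω]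

/-- Operations in the kernel of `novHom` vanish in every commutative algebra with derivations. -/
theorem evalOp_freeHom_of_mem_ker {n : ℕ} {x : (free k (novGens Ω)).carrier n}
    (hx : (novHom k Ω).app n x = 0) (f : Fin n → A) :
    evalOp D f (((novMap Ω).freeHom k).app n x) = 0 :=
  (Submodule.mem_iInf _).1
    (diffIdeal_le_vanishingIdeal D n ((Submodule.Quotient.mk_eq_zero _).1 hx)) f

end Evaluation

/-! ### Novikov tree monomials of arity three -/

section NormalForm

variable {Ω : Type v} {X : Type}

theorem Tree.Rel.leaves_perm {W : Gens.{v}} {s t : Tree W X} (h : Tree.Rel s t) :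
    s.leaves.Perm t.leaves := by
  induction h with
  | leaf x => exact .refl _
  | una ω _ ih => exact ih
  | bin θ _ _ ihs iht => exact ihs.append iht
  | swap θ _ _ ihs iht => exact (ihs.append iht).trans List.perm_append_comm

/-- A root labelled `▷'_ω` is turned into `▷_ω` by exchanging its two subtrees. -/
theorem eq_leaf_or_rel_nov (s : Tree (novGens Ω) X) :
    (∃ x, s = .leaf x) ∨ ∃ ω s₁ s₂, Tree.Rel s (nov ω s₁ s₂) := by
  rcases s with x | ω | ⟨ω | ω, s, t⟩
  · exact .inl ⟨x, rfl⟩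
  · exact PEmpty.elim ω
  · exact .inr ⟨ω, s, t, .refl _⟩
  · exact .inr ⟨ω, t, s, .swap (W := novGens Ω) _ (.refl s) (.refl t)⟩

theorem eq_leaf_of_length_leaves (s : Tree (novGens Ω) X) (hs : s.leaves.length = 1) :
    ∃ x, s = .leaf x := by
  rcases s with x | ω | ⟨θ, s, t⟩
  · exact ⟨x, rfl⟩
  · exact PEmpty.elim ω
  · have h₁ := List.length_pos_iff.2 s.leaves_ne_nil
    have h₂ := List.length_pos_iff.2 t.leaves_ne_nil
    rw [Tree.leaves, List.length_append] at hs
    omega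

theorem rel_nov_of_length_leaves (s : Tree (novGens Ω) X) (hs : s.leaves.length ≠ 1) :
    ∃ ω s₁ s₂, Tree.Rel s (nov ω s₁ s₂) ∧ 0 < s₁.leaves.length ∧ 0 < s₂.leaves.length ∧
      s₁.leaves.length + s₂.leaves.length = s.leaves.length := by
  obtain ⟨x, rfl⟩ | ⟨ω, s₁, s₂, h⟩ := eq_leaf_or_rel_nov s
  · exact absurd rfl hs
  · refine ⟨ω, s₁, s₂, h, List.length_pos_iff.2 s₁.leaves_ne_nil,
      List.length_pos_iff.2 s₂.leaves_ne_nil, ?_⟩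
    rw [h.leaves_perm.length_eq]
    exact List.length_append.symm

theorem rel_nov_leaf_leaf (s : Tree (novGens Ω) X) (hs : s.leaves.length = 2) :
    ∃ ω a b, Tree.Rel s (nov ω (.leaf a) (.leaf b)) := by
  obtain ⟨ω, s₁, s₂, h, h₁, h₂, h₃⟩ := rel_nov_of_length_leaves s (by omega)
  obtain ⟨a, rfl⟩ := eq_leaf_of_length_leaves s₁ (by omega)
  obtain ⟨b, rfl⟩ := eq_leaf_of_length_leaves s₂ (by omega)
  exact ⟨ω, a, b, h⟩

/-- The tree `(a ▷_ω b) ▷_τ c`. -/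
abbrev novLeft (a b c : X) (ω τ : Ω) : Tree (novGens Ω) X :=
  nov τ (nov ω (.leaf a) (.leaf b)) (.leaf c)

/-- The tree `a ▷_ω (b ▷_τ c)`. -/
abbrev novRight (a b c : X) (ω τ : Ω) : Tree (novGens Ω) X :=
  nov ω (.leaf a) (nov τ (.leaf b) (.leaf c))

/-- The three leaves are split at the root as `1 + 2` or as `2 + 1`. -/
theorem rel_novLeft_or_novRight (s : Tree (novGens Ω) X) (hs : s.leaves.length = 3) :
    ∃ a b c ω τ, Tree.Rel s (novLeft a b c ω τ) ∨ Tree.Rel s (novRight a b c ω τ) := by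
  obtain ⟨ω, s₁, s₂, h, h₁, h₂, h₃⟩ := rel_nov_of_length_leaves s (by omega)
  obtain h₄ | h₄ : s₁.leaves.length = 1 ∨ s₁.leaves.length = 2 := by omega
  · obtain ⟨a, rfl⟩ := eq_leaf_of_length_leaves s₁ h₄
    obtain ⟨τ, b, c, h'⟩ := rel_nov_leaf_leaf s₂ (by omega)
    exact ⟨a, b, c, ω, τ, .inr (h.trans (.bin (W := novGens Ω) _ (.refl _) h'))⟩
  · obtain ⟨τ, a, b, h'⟩ := rel_nov_leaf_leaf s₁ h₄
    obtain ⟨c, rfl⟩ := eq_leaf_of_length_leaves s₂ (by omega)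
    exact ⟨a, b, c, τ, ω, .inl (h.trans (.bin (W := novGens Ω) _ h' (.refl _)))⟩

theorem perm_finRange_three {a b c : Fin 3} (h : [a, b, c].Perm (List.finRange 3)) :
    (a, b, c) ∈ [((0 : Fin 3), (1 : Fin 3), (2 : Fin 3)), (0, 2, 1), (1, 0, 2), (1, 2, 0),
      (2, 0, 1), (2, 1, 0)] := by
  revert a b c
  decide

end NormalForm

/-! ### The Novikov relations as identities between classes -/

section NovClass

variable (k : Type u) [Field k] {Ω : Type v}

open Classical in
/-- The class of a tree modulo the relators of noncommuting multi-Novikov algebras (and `0` if the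
tree is not linear). -/
noncomputable def novClass (s : Tree (novGens Ω) (Fin 3)) :
    (free k (novGens Ω)).carrier 3 ⧸ novRel k Ω :=
  if h : s.Linear then (novRel k Ω).mkQ (tr k s h) else 0

theorem novClass_of_linear {s : Tree (novGens Ω) (Fin 3)} (h : s.Linear) :
    novClass k s = (novRel k Ω).mkQ (tr k s h) :=
  dif_pos h

theorem novClass_congr {s t : Tree (novGens Ω) (Fin 3)} (hs : s.Linear) (h : Tree.Rel s t) :
    novClass k s = novClass k t := by
  have ht : t.Linear := h.leaves_perm.symm.trans hs
  rw [novClass_of_linear k hs, novClass_of_linear k ht, tr_congr k hs ht h]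

/-- Acting by a permutation renumbers leaves by its inverse, so acting by `σ⁻¹` sends leaf `j` to `σ
j`. -/
theorem mkQ_act_tr (σ : Equiv.Perm (Fin 3)) {s : Tree (novGens Ω) (Fin 3)} (hs : s.Linear) :
    (novRel k Ω).mkQ ((free k (novGens Ω)).act σ⁻¹ (tr k s hs)) = novClass k (s.map σ) := by
  rw [novClass_of_linear k (hs.map σ), act_tr k _ _ (hs.map σ) (by rw [inv_inv])]

/-- The relator is arranged so that each side is the class attached to the monomial `a b ∂_ω ∂_τ c`,
read once as `a b` and once as `b a`. -/
theorem novClass_leftSymm (σ : Equiv.Perm (Fin 3)) {a b c : Fin 3} (ha : σ 0 = a) (hb : σ 1 = b)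
    (hc : σ 2 = c) (ω τ : Ω) :
    novClass k (novRight a b c ω τ) - novClass k (novLeft a b c ω τ) =
      novClass k (novRight b a c ω τ) - novClass k (novLeft b a c ω τ) := by
  subst ha hb hc
  have h : (novRel k Ω).mkQ ((free k (novGens Ω)).act σ⁻¹ (leftSymmRel k ω τ)) = 0 :=
    (Submodule.Quotient.mk_eq_zero _).2 (Submodule.subset_span ⟨σ⁻¹, ω, τ, .inl rfl⟩)
  rw [leftSymmRel] at h
  simp only [map_add, map_sub, mkQ_act_tr] at h
  have symm : ∀ {p q r s : (free k (novGens Ω)).carrier 3 ⧸ novRel k Ω}, p - q - r + s = 0 →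
      q - p = s - r := fun {p q r s} h => by
    rw [← sub_eq_zero, ← neg_eq_zero, ← h]
    abel
  exact symm h

theorem novClass_rightComm (σ : Equiv.Perm (Fin 3)) {a b c : Fin 3} (ha : σ 0 = a) (hb : σ 1 = b)
    (hc : σ 2 = c) (ω τ : Ω) :
    novClass k (novLeft a b c ω τ) = novClass k (novLeft a c b τ ω) := by
  subst ha hb hc
  have h : (novRel k Ω).mkQ ((free k (novGens Ω)).act σ⁻¹ (rightCommRel k ω τ)) = 0 :=
    (Submodule.Quotient.mk_eq_zero _).2 (Submodule.subset_span ⟨σ⁻¹, ω, τ, .inr rfl⟩)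
  rw [rightCommRel] at h
  simp only [map_sub, mkQ_act_tr] at h
  exact sub_eq_zero.1 h

end NovClass

/-! ### Differential polynomials and the inverse of evaluation modulo `R` -/

section FreeDifferentialAlgebra

open MvPolynomial

variable (k : Type u) [Field k] {Ω : Type v}

/-- The derivations of the free commutative differential algebra on three generators: the variable
`(i, [ω₁, …, ωₗ])` is `∂_{ω₁} ⋯ ∂_{ωₗ} xᵢ`. -/
noncomputable def freeDer (ω : Ω) : Derivation k (MvPolynomial (Fin 3 × List Ω) k)
    (MvPolynomial (Fin 3 × List Ω) k) :=
  mkDerivation k fun p => X (p.1, ω :: p.2)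

theorem freeDer_X (ω : Ω) (i : Fin 3) (w : List Ω) :
    freeDer k ω (X (i, w)) = X (i, ω :: w) :=
  mkDerivation_X _ _ _

/-- The exponent of the monomial `∏ i, ∂_{w i} xᵢ`. -/
noncomputable def wordExp (w : Fin 3 → List Ω) : Fin 3 × List Ω →₀ ℕ :=
  ∑ i, Finsupp.single (i, w i) 1

/-- The word `w i` is the only `l` for which the exponent of `(i, l)` is nonzero. Injectivity allows
values to be prescribed freely on the monomials `∏ i, ∂_{w i} xᵢ`. -/
theorem wordExp_injective : Function.Injective (wordExp (Ω := Ω)) := by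
  classical
  have key : ∀ (w : Fin 3 → List Ω) (i : Fin 3) (l : List Ω),
      wordExp w (i, l) = if w i = l then 1 else 0 := by
    intro w i l
    rw [wordExp, Finsupp.finsetSum_apply, Finset.sum_eq_single i]
    · simp [Finsupp.single_apply]
    · intro j _ hj
      simp [hj]
    · simp
  intro w w' h
  funext i
  have := key w' i (w i)
  rw [← h, key w i (w i), if_pos rfl] at this
  by_contra hne
  rw [if_neg (Ne.symm hne)] at this
  exact one_ne_zero this

theorem X_mul_X_mul_X (w : Fin 3 → List Ω) :
    (X (0, w 0) * X (1, w 1) * X (2, w 2) : MvPolynomial (Fin 3 × List Ω) k) =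
      monomial (wordExp w) 1 := by
  simp only [X, monomial_mul, wordExp, Fin.sum_univ_three, one_mul]

/-- The classes of the Novikov operations that correspond to the monomials `a ∂_ω b ∂_τ c` and
`a b ∂_ω ∂_τ c`. -/
noncomputable def wordClass : List Ω → List Ω → List Ω →
    (free k (novGens Ω)).carrier 3 ⧸ novRel k Ω
  -- The three words act on `x₀`, `x₁`, `x₂`. Of the two Novikov expressions for a monomial, the one
  -- chosen has its interchangeable variables in increasing order: the two differentiated ones in
  -- the first three cases, the two undifferentiated ones in the next three. All other monomials get
  -- `0`; they do not occur in values of arity three Novikov trees.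
  | [], [ω], [τ] => novClass k (novLeft 0 1 2 ω τ)
  | [ω], [], [τ] => novClass k (novLeft 1 0 2 ω τ)
  | [ω], [τ], [] => novClass k (novLeft 2 0 1 ω τ)
  | [], [], [ω, τ] => novClass k (novRight 0 1 2 ω τ) - novClass k (novLeft 0 1 2 ω τ)
  | [], [ω, τ], [] => novClass k (novRight 0 2 1 ω τ) - novClass k (novLeft 0 2 1 ω τ)
  | [ω, τ], [], [] => novClass k (novRight 1 2 0 ω τ) - novClass k (novLeft 1 2 0 ω τ)
  | _, _, _ => 0

/-- The linear extension of `wordClass` to differential polynomials. -/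
noncomputable def polyClass : MvPolynomial (Fin 3 × List Ω) k →ₗ[k]
    (free k (novGens Ω)).carrier 3 ⧸ novRel k Ω :=
  (basisMonomials (Fin 3 × List Ω) k).constr k
    (Function.extend wordExp (fun w => wordClass k (w 0) (w 1) (w 2)) 0)

theorem polyClass_X (u v w : List Ω) :
    polyClass k (X (0, u) * X (1, v) * X (2, w)) = wordClass k u v w := by
  rw [show (X (0, u) * X (1, v) * X (2, w) : MvPolynomial (Fin 3 × List Ω) k) = _ from
    X_mul_X_mul_X k ![u, v, w], polyClass,
    ← congrFun (coe_basisMonomials (Fin 3 × List Ω) k) (wordExp ![u, v, w]), Module.Basis.constr_basis,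
    wordExp_injective.extend_apply]
  rfl

theorem evalTree_novLeft (a b c : Fin 3) (ω τ : Ω) :
    evalTree (freeDer k) (fun i => X (i, [])) ((novMap Ω).subst (novLeft a b c ω τ)) =
      X (a, []) * X (b, [ω]) * X (c, [τ]) := by
  change X (a, []) * freeDer k ω (X (b, [])) * freeDer k τ (X (c, [])) = _
  rw [freeDer_X, freeDer_X]

theorem evalTree_novRight (a b c : Fin 3) (ω τ : Ω) :
    evalTree (freeDer k) (fun i => X (i, [])) ((novMap Ω).subst (novRight a b c ω τ)) =
      X (a, []) * X (b, [ω]) * X (c, [τ]) + X (a, []) * X (b, []) * X (c, [ω, τ]) := by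
  change X (a, []) * freeDer k ω (X (b, []) * freeDer k τ (X (c, []))) = _
  rw [Derivation.leibniz, freeDer_X, freeDer_X, freeDer_X, smul_eq_mul, smul_eq_mul]
  ring

/-- For `b < c` the expression is the representative chosen in `wordClass`; in the three other cases
right commutativity exchanges `(b, ω)` and `(c, τ)`. -/
theorem polyClass_novLeft {a b c : Fin 3} (h : [a, b, c].Perm (List.finRange 3)) (ω τ : Ω) :
    polyClass k (X (a, []) * X (b, [ω]) * X (c, [τ])) = novClass k (novLeft a b c ω τ) := by
  -- The rearrangements that bring the factors into the order `x₀, x₁, x₂` required by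
  -- `polyClass_X`.
  have e : ∀ a b c : MvPolynomial (Fin 3 × List Ω) k, a * b * c = a * c * b ∧ a * b * c = b * a * c
      ∧ a * b * c = c * a * b ∧ a * b * c = b * c * a ∧ a * b * c = c * b * a :=
    fun a b c => ⟨by ring, by ring, by ring, by ring, by ring⟩
  have h' := perm_finRange_three h
  simp only [List.mem_cons, Prod.mk.injEq, List.not_mem_nil, or_false] at h'
  rcases h' with ⟨rfl, rfl, rfl⟩ | ⟨rfl, rfl, rfl⟩ | ⟨rfl, rfl, rfl⟩ | ⟨rfl, rfl, rfl⟩ |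
    ⟨rfl, rfl, rfl⟩ | ⟨rfl, rfl, rfl⟩
  · exact polyClass_X k _ _ _
  · rw [(e _ _ _).1, polyClass_X]
    exact novClass_rightComm k 1 (by decide) (by decide) (by decide) τ ω
  · rw [(e _ _ _).2.1, polyClass_X]
    rfl
  · rw [(e _ _ _).2.2.1, polyClass_X]
    exact novClass_rightComm k (Equiv.swap 0 1) (by decide) (by decide) (by decide) τ ω
  · rw [(e _ _ _).2.2.2.1, polyClass_X]
    rfl
  · rw [(e _ _ _).2.2.2.2, polyClass_X]
    exact novClass_rightComm k (Equiv.swap 0 1 * Equiv.swap 0 2) (by decide) (by decide)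
      (by decide) τ ω

/-- For `a < b` the expression is the chosen representative; in the three other cases left symmetry
exchanges `a` and `b`. -/
theorem polyClass_novRight {a b c : Fin 3} (h : [a, b, c].Perm (List.finRange 3)) (ω τ : Ω) :
    polyClass k (X (a, []) * X (b, []) * X (c, [ω, τ])) =
      novClass k (novRight a b c ω τ) - novClass k (novLeft a b c ω τ) := by
  have e : ∀ a b c : MvPolynomial (Fin 3 × List Ω) k, a * b * c = a * c * b ∧ a * b * c = b * a * c
      ∧ a * b * c = c * a * b ∧ a * b * c = b * c * a ∧ a * b * c = c * b * a :=
    fun a b c => ⟨by ring, by ring, by ring, by ring, by ring⟩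
  have h' := perm_finRange_three h
  simp only [List.mem_cons, Prod.mk.injEq, List.not_mem_nil, or_false] at h'
  rcases h' with ⟨rfl, rfl, rfl⟩ | ⟨rfl, rfl, rfl⟩ | ⟨rfl, rfl, rfl⟩ | ⟨rfl, rfl, rfl⟩ |
    ⟨rfl, rfl, rfl⟩ | ⟨rfl, rfl, rfl⟩
  · exact polyClass_X k _ _ _
  · rw [(e _ _ _).1, polyClass_X]
    rfl
  · rw [(e _ _ _).2.1, polyClass_X]
    exact novClass_leftSymm k 1 (by decide) (by decide) (by decide) ω τ
  · rw [(e _ _ _).2.2.1, polyClass_X]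
    rfl
  · rw [(e _ _ _).2.2.2.1, polyClass_X]
    exact novClass_leftSymm k (Equiv.swap 1 2) (by decide) (by decide) (by decide) ω τ
  · rw [(e _ _ _).2.2.2.2, polyClass_X]
    exact novClass_leftSymm k (Equiv.swap 0 2 * Equiv.swap 0 1) (by decide) (by decide)
      (by decide) ω τ

theorem polyClass_evalTree {s : Tree (novGens Ω) (Fin 3)} (hs : s.Linear) :
    polyClass k (evalTree (freeDer k) (fun i => X (i, [])) ((novMap Ω).subst s)) =
      novClass k s := by
  obtain ⟨a, b, c, ω, τ, h | h⟩ := rel_novLeft_or_novRight s hs.length_eq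
  · have hp : [a, b, c].Perm (List.finRange 3) := h.leaves_perm.symm.trans hs
    rw [evalTree_rel (freeDer k) _ ((novMap Ω).subst_rel h), novClass_congr k hs h,
      evalTree_novLeft, polyClass_novLeft k hp]
  -- By the Leibniz rule the value has two monomials; the class of `(a ▷_ω b) ▷_τ c` from the first
  -- cancels the correction term of the second.
  · have hp : [a, b, c].Perm (List.finRange 3) := h.leaves_perm.symm.trans hs
    rw [evalTree_rel (freeDer k) _ ((novMap Ω).subst_rel h), novClass_congr k hs h,
      evalTree_novRight, map_add, polyClass_novLeft k hp, polyClass_novRight k hp, add_sub_cancel]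

/-- Evaluation at the generators thus loses nothing beyond `R`. Both sides are linear in `x`, so
tree monomials suffice. -/
theorem polyClass_evalOp (x : (free k (novGens Ω)).carrier 3) :
    polyClass k (evalOp (freeDer k) (fun i => X (i, [])) (((novMap Ω).freeHom k).app 3 x)) =
      (novRel k Ω).mkQ x := by
  have h : (polyClass k).comp ((evalOp (freeDer k) (fun i => X (i, []))).comp
      (((novMap Ω).freeHom k).app 3)) = (novRel k Ω).mkQ := by
    refine Finsupp.lhom_ext' (R := k) (M := k) fun a => LinearMap.ext_ring ?_
    induction a using Mon.ind with
    | h s hs =>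
      refine Eq.trans ?_ (novClass_of_linear k hs)
      refine Eq.trans (congrArg (fun y => polyClass k (evalOp (freeDer k) (fun i => X (i, [])) y))
        ((novMap Ω).freeHom_tr k s hs)) ?_
      rw [evalOp_tr, polyClass_evalTree k hs]
  exact LinearMap.congr_fun h x

/-- The relators of noncommuting multi-Novikov algebras are the kernel of `novHom` in arity `3`. -/
theorem ker_novHom : LinearMap.ker ((novHom k Ω).app 3) = novRel k Ω := by
  refine le_antisymm (fun x hx => ?_) (novRel_le_ker k)
  rw [← (novRel k Ω).ker_mkQ, LinearMap.mem_ker, ← polyClass_evalOp,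
    evalOp_freeHom_of_mem_ker (freeDer k) hx, map_zero]

end FreeDifferentialAlgebra

end InducedStructure

open InducedStructure in
/-- The operad of noncommuting multi-Novikov algebras is the pre-induced operad of the operad of
commutative algebras with not necessarily commuting derivations (with `▷_ω` corresponding to
`≺_{ω,μ}` and `▷'_ω` to `≻_{ω,μ}`), and the relators of noncommuting multi-Novikov algebras are
exactly the kernel, in arity `3`, of the morphism `▷_ω ↦ μ(id ⊗ ∂_ω)`, `▷'_ω ↦ μ'(∂_ω ⊗ id)`. -/
theorem theorem4p3 (k : Type*) [Field k] (Ω : Type*) :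
    (∃ e : (NCMultiNov k Ω).Hom (preInduced k (diffGens Ω) (diffRel k Ω)),
      (∀ n, Function.Bijective (e.app n)) ∧
      ∀ ω : Ω,
        e.app 2 (gen₂ k (novRelSet k Ω) (NovSymbol.op ω)) =
          gen₂ k (preRel k (diffGens Ω) (diffRel k Ω)) (PreSymbol.prec ω PUnit.unit) ∧
        e.app 2 (gen₂ k (novRelSet k Ω) (NovSymbol.opp ω)) =
          gen₂ k (preRel k (diffGens Ω) (diffRel k Ω)) (PreSymbol.succ ω PUnit.unit)) ∧
    LinearMap.ker ((novHom k Ω).app 3) = novRel k Ω := by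
  exact ⟨exists_iso_preInduced k Ω (ker_novHom k), ker_novHom k⟩
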